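/- **Theorem 6.10.** An NFA $A=(Q,\Sigma,\cdot,I,F)$ (with $Q$ finite and nonempty, $I,F\subseteq Q$ and $\cdot : Q\times\Sigma\to 2^Q$) accepts the language $L(A)=\{w\in\Sigma^*\mid (I\cdot w)\cap F\neq\emptyset\}$. It is *complete* if $q\cdot a\ne\emptyset$ for all $q\in Q$ and $a\in\Sigma$, and *partially ordered* if the reachability relation on $Q$ is a partial order. It has the *unique maximal state property* if every state $p$ is the unique maximal state of the connected component containing $p$ of the graph on $Q$ whose edges are the transitions of $A$ under the letters of $\Sigma(p)=\{a\in\Sigma\mid p\in p\cdot a\}$; here components are those of the underlying undirected graph, and a state is maximal if no other state is reachable from it in the directed graph. A *ptNFA* is a complete, partially ordered NFA with the unique maximal state property. The *depth* of $A$ is the number of transitions on a longest simple path starting in an initial state ($0$ if there is no initial state). A language over $\Sigma$ is *$k$-piecewise testable* if it is a finite Boolean combination of languages $\Sigma^*a_1\Sigma^*\cdots\Sigma^*a_n\Sigma^*$ with $a_i\in\Sigma$ and $0\le n\le k$. Let the alphabet be unary, $\Sigma=\{a\}$. Then the $k$-piecewise testability problem for ptNFAs is decidable in polynomial time even if $k$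 is part of the input: there is a Turing machine which, given an NFA $A$ over $\{a\}$ (by its initial states, its accepting states and its transition matrix) and a number $k\ge 0$ in binary, decides in time polynomial in the length of the input whether $A$ is a ptNFA and $L(A)$ is $k$-piecewise testable. Moreover, for every ptNFA $A$ over $\{a\}$ and every $k\ge 0$, the language $L(A)$ is $k$-piecewise testable if and only if, for all $j$ with $k<j\le \operatorname{depth}(A)$, the word $a^j$ is accepted by $A$ exactly when $a^k$ is. -/

import Mathlib

/-! ### Piecewise testable languages -/

/-- The language `Σ* a₁ Σ* a₂ Σ* ⋯ Σ* aₙ Σ*` of the words into which `u = a₁ a₂ ⋯ aₙ` embeds. -/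
def pieceLanguage {α : Type*} : List α → Language α
  | [] => ⊤
  | a :: u => ⊤ * {[a]} * pieceLanguage u

/-- A language is `k`-piecewise testable if it is a finite boolean combination of languages
`Σ* a₁ Σ* ⋯ Σ* aₙ Σ*` with `n ≤ k`. -/
def IsKPiecewiseTestable {α : Type*} (k : ℕ) (L : Language α) : Prop :=
  L ∈ BooleanSubalgebra.closure {P : Language α | ∃ u : List α, u.length ≤ k ∧ P = pieceLanguage u}

/-! ### ptNFAs -/

/-- The edge relation of the directed graph `G(A, Γ)` on the states of `A`. -/
def NFA.GraphEdge {α σ : Type*} (A : NFA α σ) (Γ : Set α) (p q : σ) : Prop :=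
  ∃ a ∈ Γ, q ∈ A.step p a

/-- The reachability relation `p ≤ q` on states: some word leads from `p` to `q`. -/
def NFA.Reaches {α σ : Type*} (A : NFA α σ) (p q : σ) : Prop :=
  ∃ w : List α, q ∈ A.evalFrom {p} w

/-- In every state, there is a transition under every letter. -/
def NFA.IsComplete {α σ : Type*} (A : NFA α σ) : Prop :=
  ∀ p a, (A.step p a).Nonempty

/-- The reachability relation is a partial order. -/
def NFA.IsPartiallyOrdered {α σ : Type*} (A : NFA α σ) : Prop :=
  IsPartialOrder σ A.Reaches

/-- The set `Σ(p)` of the letters under which there is a self-loop in the state `p`. -/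
def NFA.loopLetters {α σ : Type*} (A : NFA α σ) (p : σ) : Set α :=
  {a | p ∈ A.step p a}

/-- The state `q` is maximal in `G(A, Γ)`: no other state is reachable from it in that graph. -/
def NFA.IsMaximalIn {α σ : Type*} (A : NFA α σ) (Γ : Set α) (q : σ) : Prop :=
  ∀ r, Relation.ReflTransGen (A.GraphEdge Γ) q r → r = q

/-- The unique maximal state property: every state `p` is the unique maximal state of the
connected component of `G(A, Σ(p))` containing `p` (edges are taken without orientation in
the notion of a connected component). -/
def NFA.HasUMS {α σ : Type*} (A : NFA α σ) : Prop :=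
  ∀ p q, Relation.EqvGen (A.GraphEdge (A.loopLetters p)) p q →
    (A.IsMaximalIn (A.loopLetters p) q ↔ q = p)

/-- A ptNFA is a partially ordered complete NFA with the unique maximal state property. -/
def NFA.IsPtNFA {α σ : Type*} (A : NFA α σ) : Prop :=
  A.IsPartiallyOrdered ∧ A.IsComplete ∧ A.HasUMS

/-- The number of transitions of a longest simple path that starts in an initial state. A simple
path is given by the list of its states. -/
noncomputable def NFA.depth {α σ : Type*} (A : NFA α σ) : ℕ :=
  sSup {m | ∃ l : List σ, l.Nodup ∧ l.IsChain (A.GraphEdge Set.univ) ∧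
    (∃ q ∈ A.start, l.head? = some q) ∧ l.length = m + 1}

/-! ### The decision problem -/

/-- An NFA over a one-letter alphabet with a finite nonempty set of states, namely `Fin (n + 1)`
for some `n`. -/
abbrev UnaryNFA : Type := Σ n : ℕ, NFA Unit (Fin (n + 1))

open Classical in
/-- The row of a state: is it initial, is it accepting, and its row of the transition matrix,
closed by the separator `none`. -/
noncomputable def encodeState {n : ℕ} (A : NFA Unit (Fin (n + 1))) (p : Fin (n + 1)) :
    List (Option Bool) :=
  some (decide (p ∈ A.start)) :: some (decide (p ∈ A.accept)) ::
    ((List.finRange (n + 1)).map fun q => some (decide (q ∈ A.step p ()))) ++ [none]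

/-- The encoding of a pair of a unary NFA and a number: the number in binary, a separator, and
the rows of all states. -/
noncomputable def encodeInstance (x : UnaryNFA × ℕ) : List (Option Bool) :=
  (Computability.encodeNat x.2).map some ++
    none :: (List.finRange (x.1.1 + 1)).flatMap (encodeState x.1.2)

/-- The set `S` is decidable in polynomial time, under the given encoding of its ambient type by
words over a finite alphabet: a Turing machine computes its characteristic function in a time
polynomial in the length of the encoding. -/
def DecidableInPolyTime {X Γ : Type} (encode : X → List Γ) (S : Set X) : Prop :=
  ∃ f : X → Bool, (∀ x, f x = true ↔ x ∈ S) ∧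
    Nonempty (Turing.TM2ComputableInPolyTime encode Computability.encodeBool f)

/-! ### Piecewise testable languages over a one-letter alphabet -/

/-! A word over one letter is its length, and the piece language of a word of length `n` consists of
the lengths at least `n`. The Boolean combinations of pieces of length at most `k` are therefore
exactly the sets of lengths whose membership is constant from `k` on
(`isKPiecewiseTestable_unit_iff`).

In a unary ptNFA, `Σ(p)` is everything or empty. If `p` has a loop, the graph in the unique maximal
state property is the whole transition graph, so `p` has no other successor and is the only looped
state of its component (`eq_of_reachesIn_of_loop`). A path that ends in a loopless state visits
loopless states only, is simple by antisymmetry, and by completeness extends by one transition to a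
longer simple path (`exists_simple_path`). Hence a path from an initial state with at least `depth`
transitions ends in the unique looped state of its component, whatever its length, and acceptance is
constant from `depth` on. This gives the criterion.

For the algorithm, let `m` be at least the number of states. Then `A` is a ptNFA if and only if,
from every state, the sets reached in exactly `m` and exactly `m + 1` steps are the same singleton
(`isPtNFA_iff`). Both this test and the comparison of words only iterate the successor map on bit
vectors. The bound `m` is taken to be the input length `n`, and `k` may be replaced by `min k n`
because acceptance of a ptNFA is constant from `n` on; so a binary `k` of exponential size costs
only `n` decrements.

For the running time, the procedure is written in a small language whose loops all run exactly `n`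
times. The cost of such a program is a polynomial in `n` by recursion on its syntax, and one
compilation theorem (`reachesIn_code`) turns every program into a Turing machine. What remains is to
evaluate one concrete program. -/

theorem eq_replicate_unit (w : List Unit) : w = List.replicate w.length () :=
  List.eq_replicate_iff.2 ⟨rfl, fun _ _ => rfl⟩

theorem mem_pieceLanguage_unit_iff (u w : List Unit) :
    w ∈ pieceLanguage u ↔ u.length ≤ w.length := by
  induction u generalizing w with
  | nil => exact iff_of_true (Set.mem_univ w) (Nat.zero_le _)
  | cons a u ih =>
    simp only [pieceLanguage, Language.mem_mul, List.length_cons]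
    constructor
    · rintro ⟨_, ⟨x, _, y, hy, rfl⟩, z, hz, rfl⟩
      obtain rfl : y = [a] := hy
      have := (ih z).1 hz
      simp
      omega
    · intro h
      cases w with
      | nil => simp at h
      | cons b w =>
        exact ⟨[b], ⟨[], Set.mem_univ _, [b], rfl, rfl⟩, w, (ih w).2 (by simpa using h), rfl⟩

/-- Constancy from `k` on holds for each generator and survives Boolean operations. Conversely, `L`
splits into single lengths `i < k`, each a difference of two consecutive pieces, and the tail of
lengths at least `k`, which lies in `L` entirely or not at all. -/
theorem isKPiecewiseTestable_unit_iff (k : ℕ) (L : Language Unit) :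
    IsKPiecewiseTestable k L ↔
      ∀ j, k < j → (List.replicate j () ∈ L ↔ List.replicate k () ∈ L) := by
  constructor
  · intro h
    refine BooleanSubalgebra.closure_bot_sup_induction
      (p := fun L _ => ∀ j, k < j → (List.replicate j () ∈ L ↔ List.replicate k () ∈ L))
      ?_ ?_ ?_ ?_ h
    · rintro _ ⟨u, hu, rfl⟩ j hj
      simp only [mem_pieceLanguage_unit_iff, List.length_replicate]
      omega
    · exact fun j _ => Iff.rfl
    · intro L _ M _ hL hM j hj
      exact or_congr (hL j hj) (hM j hj)
    · intro L _ hL j hj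
      exact not_congr (hL j hj)
  · intro h
    set C := BooleanSubalgebra.closure
      {P : Language Unit | ∃ u : List Unit, u.length ≤ k ∧ P = pieceLanguage u} with hC
    have hpiece : ∀ i ≤ k, pieceLanguage (List.replicate i ()) ∈ C := fun i hi =>
      BooleanSubalgebra.subset_closure ⟨List.replicate i (), by simpa using hi, rfl⟩
    have hmem : ∀ i (w : List Unit), w ∈ pieceLanguage (List.replicate i ()) ↔ i ≤ w.length :=
      fun i w => by simp [mem_pieceLanguage_unit_iff]
    have hshort : ∀ i ≤ k, L ⊓ (pieceLanguage (List.replicate i ()))ᶜ ∈ C := by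
      intro i
      induction i with
      | zero =>
        intro _
        have : L ⊓ (pieceLanguage (List.replicate 0 ()))ᶜ = ⊥ := by
          ext w
          exact iff_of_false (fun hw => hw.2 ((hmem 0 w).2 (Nat.zero_le _))) id
        rw [this]
        exact BooleanSubalgebra.bot_mem
      | succ i ih =>
        intro hi
        have hlevel : pieceLanguage (List.replicate i ()) ⊓
            (pieceLanguage (List.replicate (i + 1) ()))ᶜ ∈ C :=
          BooleanSubalgebra.inf_mem (hpiece i (by omega))
            (BooleanSubalgebra.compl_mem (hpiece (i + 1) hi))
        have hlevel' : ∀ w : List Unit, w ∈ pieceLanguage (List.replicate i ()) ⊓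
            (pieceLanguage (List.replicate (i + 1) ()))ᶜ ↔ w.length = i := by
          intro w
          refine (and_congr (hmem i w) (not_congr (hmem (i + 1) w))).trans ?_
          omega
        have hcompl : ∀ i (w : List Unit),
            w ∈ L ⊓ (pieceLanguage (List.replicate i ()))ᶜ ↔ w ∈ L ∧ w.length < i := by
          intro i w
          exact and_congr_right fun _ => (not_congr (hmem i w)).trans not_le
        by_cases hL : List.replicate i () ∈ L
        · convert BooleanSubalgebra.sup_mem (ih (by omega)) hlevel using 1
          ext w
          rw [hcompl]
          refine Iff.trans ?_ (or_congr (hcompl i w) (hlevel' w)).symm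
          constructor
          · rintro ⟨h1, h2⟩
            rcases Nat.lt_succ_iff_lt_or_eq.1 h2 with h3 | h3
            · exact Or.inl ⟨h1, h3⟩
            · exact Or.inr h3
          · rintro (⟨h1, h2⟩ | h1)
            · exact ⟨h1, by omega⟩
            · refine ⟨?_, by omega⟩
              rwa [eq_replicate_unit w, h1]
        · convert ih (by omega) using 1
          ext w
          rw [hcompl, hcompl]
          refine and_congr_right fun hw => ⟨fun h1 => ?_, fun h1 => by omega⟩
          refine lt_of_le_of_ne (by omega) fun h2 => hL ?_
          rwa [← h2, ← eq_replicate_unit w]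
    have hlong : ∀ w : List Unit, k ≤ w.length → (w ∈ L ↔ List.replicate k () ∈ L) := by
      intro w hw
      rw [eq_replicate_unit w]
      rcases hw.eq_or_lt with h1 | h1
      · rw [h1]
      · exact h _ h1
    have hcases : L ⊓ pieceLanguage (List.replicate k ()) ∈ C := by
      by_cases hL : List.replicate k () ∈ L
      · convert hpiece k le_rfl using 1
        exact inf_eq_right.2 fun w hw => (hlong w ((hmem k w).1 hw)).2 hL
      · convert (BooleanSubalgebra.bot_mem : ⊥ ∈ C) using 1
        ext w
        exact iff_of_false (fun hw => hL ((hlong w ((hmem k w).1 hw.2)).1 hw.1)) id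
    have hsplit : L = (L ⊓ pieceLanguage (List.replicate k ())) ⊔
        (L ⊓ (pieceLanguage (List.replicate k ()))ᶜ) := by
      rw [← inf_sup_left, sup_compl_eq_top, inf_top_eq]
    rw [IsKPiecewiseTestable, ← hC, hsplit]
    exact BooleanSubalgebra.sup_mem hcases (hshort k le_rfl)

/-! ### Unary ptNFAs -/

namespace NFA

variable {σ : Type*} {A : NFA Unit σ}

/-- Some path of length `j` leads from `p` to `q`. -/
def ReachesIn (A : NFA Unit σ) (j : ℕ) (p q : σ) : Prop :=
  q ∈ A.evalFrom {p} (List.replicate j ())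

theorem reachesIn_zero {p q : σ} : A.ReachesIn 0 p q ↔ q = p := Iff.rfl

theorem reachesIn_one {p q : σ} : A.ReachesIn 1 p q ↔ q ∈ A.step p () := by
  simp [ReachesIn]

theorem reachesIn_add {i j : ℕ} {p q : σ} :
    A.ReachesIn (i + j) p q ↔ ∃ r, A.ReachesIn i p r ∧ A.ReachesIn j r q := by
  rw [ReachesIn, List.replicate_add, evalFrom_append, mem_evalFrom_iff_exists]
  rfl

theorem reachesIn_succ {j : ℕ} {p q : σ} :
    A.ReachesIn (j + 1) p q ↔ ∃ r ∈ A.step p (), A.ReachesIn j r q := by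
  rw [add_comm, reachesIn_add]
  simp [reachesIn_one]

theorem reaches_iff_exists_reachesIn {p q : σ} : A.Reaches p q ↔ ∃ j, A.ReachesIn j p q := by
  constructor
  · rintro ⟨w, hw⟩
    exact ⟨w.length, by rwa [ReachesIn, ← eq_replicate_unit w]⟩
  · rintro ⟨j, hj⟩
    exact ⟨_, hj⟩

theorem Reaches.refl (p : σ) : A.Reaches p p := ⟨[], rfl⟩

theorem Reaches.trans {p q r : σ} (h : A.Reaches p q) (h' : A.Reaches q r) : A.Reaches p r := by
  rw [reaches_iff_exists_reachesIn] at *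
  obtain ⟨i, h⟩ := h
  obtain ⟨j, h'⟩ := h'
  exact ⟨i + j, reachesIn_add.2 ⟨q, h, h'⟩⟩

theorem reaches_of_mem_step {p q : σ} (h : q ∈ A.step p ()) : A.Reaches p q :=
  reaches_iff_exists_reachesIn.2 ⟨1, reachesIn_one.2 h⟩

theorem replicate_mem_accepts_iff {j : ℕ} :
    List.replicate j () ∈ A.accepts ↔ ∃ p ∈ A.start, ∃ q ∈ A.accept, A.ReachesIn j p q := by
  change (∃ q ∈ A.accept, q ∈ A.evalFrom A.start _) ↔ _
  simp only [mem_evalFrom_iff_exists (S := A.start)]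
  constructor
  · rintro ⟨q, hq, p, hp, h⟩
    exact ⟨p, hp, q, hq, h⟩
  · rintro ⟨p, hp, q, hq, h⟩
    exact ⟨q, hq, p, hp, h⟩

/-- A loop at `p` puts the only letter into `Σ(p)`, so the graph of the unique maximal state
property is the same for all looped states. -/
theorem graphEdge_loopLetters_iff {p a b : σ} (hp : p ∈ A.step p ()) :
    A.GraphEdge (A.loopLetters p) a b ↔ b ∈ A.step a () :=
  ⟨fun ⟨_, _, h⟩ => h, fun h => ⟨(), hp, h⟩⟩

theorem ReachesIn.reflTransGen {p : σ} (hp : p ∈ A.step p ()) {j : ℕ} {a b : σ}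
    (h : A.ReachesIn j a b) : Relation.ReflTransGen (A.GraphEdge (A.loopLetters p)) a b := by
  induction j generalizing a with
  | zero => rw [reachesIn_zero.1 h]
  | succ j ih =>
    obtain ⟨r, hr, h⟩ := reachesIn_succ.1 h
    exact .head ((graphEdge_loopLetters_iff hp).2 hr) (ih h)

theorem ReachesIn.eqvGen {p : σ} (hp : p ∈ A.step p ()) {j : ℕ} {a b : σ}
    (h : A.ReachesIn j a b) : Relation.EqvGen (A.GraphEdge (A.loopLetters p)) a b :=
  Relation.EqvGen.reflTransGen_le_eqvGen _ _ _ (h.reflTransGen hp)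

/-! ### Loops and long paths in unary ptNFAs -/

namespace IsPtNFA

theorem antisymm (h : A.IsPtNFA) {p q : σ} (hpq : A.Reaches p q) (hqp : A.Reaches q p) : p = q :=
  h.1.antisymm p q hpq hqp

/-- The property at `q` itself makes `q` maximal in its own graph, which is also the graph of `p`.
-/
theorem isMaximalIn (h : A.IsPtNFA) {p q : σ} (hp : p ∈ A.step p ()) (hq : q ∈ A.step q ()) :
    A.IsMaximalIn (A.loopLetters p) q := by
  intro r hr
  refine (h.2.2 q q (.refl q)).2 rfl r (Relation.ReflTransGen.mono (fun a b hab => ?_) _ _ hr)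
  exact (graphEdge_loopLetters_iff hq).2 ((graphEdge_loopLetters_iff hp).1 hab)

/-- Both states lie in the component of `p` and both are maximal there. The lengths `i` and `j` may
differ, which is what makes acceptance eventually constant. -/
theorem eq_of_reachesIn_of_loop (h : A.IsPtNFA) {i j : ℕ} {p q r : σ} (hpq : A.ReachesIn i p q)
    (hpr : A.ReachesIn j p r) (hq : q ∈ A.step q ()) (hr : r ∈ A.step r ()) : r = q :=
  (h.2.2 q r (.trans _ _ _ (.symm _ _ (hpq.eqvGen hq))
    (hpr.eqvGen hq))).1 (h.isMaximalIn hq hr)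

theorem exists_reachesIn (h : A.IsPtNFA) (j : ℕ) (p : σ) : ∃ q, A.ReachesIn j p q := by
  induction j generalizing p with
  | zero => exact ⟨p, rfl⟩
  | succ j ih =>
    obtain ⟨r, hr⟩ := h.2.1 p ()
    obtain ⟨q, hq⟩ := ih r
    exact ⟨q, reachesIn_succ.2 ⟨r, hr, hq⟩⟩

/-- A looped state is maximal in the full graph, so it reaches nothing but itself. -/
theorem not_loop_of_reachesIn (h : A.IsPtNFA) {j : ℕ} {p q : σ} (hpq : A.ReachesIn j p q)
    (hq : q ∉ A.step q ()) : p ∉ A.step p () := by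
  intro hp
  refine hq ?_
  have : q = p := (h.2.2 p p (.refl p)).2 rfl q (hpq.reflTransGen hp)
  rwa [this]

/-- A path to a state without a loop can be extended by one more transition to a simple path. -/
theorem exists_simple_path (h : A.IsPtNFA) {j : ℕ} {p q r : σ} (hpq : A.ReachesIn j p q)
    (hq : q ∉ A.step q ()) (hr : r ∈ A.step q ()) :
    ∃ l : List σ, l.Nodup ∧ l.IsChain (A.GraphEdge Set.univ) ∧ l.head? = some p ∧
      l.length = j + 2 ∧ ∀ x ∈ l, A.Reaches p x := by
  induction j generalizing p with
  | zero =>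
    obtain rfl := reachesIn_zero.1 hpq
    have hne : q ≠ r := fun e => hq (e ▸ hr)
    refine ⟨[q, r], by simpa using hne, ?_, rfl, rfl, ?_⟩
    · exact List.isChain_cons_cons.2 ⟨⟨(), trivial, hr⟩, List.isChain_singleton _⟩
    · simpa using ⟨Reaches.refl q, reaches_of_mem_step hr⟩
  | succ j ih =>
    have hp := h.not_loop_of_reachesIn hpq hq
    obtain ⟨s, hs, hsq⟩ := reachesIn_succ.1 hpq
    obtain ⟨l, h1, h2, h3, h4, h5⟩ := ih hsq
    refine ⟨p :: l, List.nodup_cons.2 ⟨fun hpl => hp ?_, h1⟩, ?_, rfl, by simp [h4], ?_⟩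
    -- If `p` recurred, antisymmetry would identify it with its successor `s` and thus give `p` a
    -- loop.
    · have := h.antisymm (reaches_of_mem_step hs) (h5 p hpl)
      rwa [← this] at hs
    · obtain ⟨l', rfl⟩ : ∃ l', l = s :: l' := by
        cases l with
        | nil => simp at h3
        | cons a l' => exact ⟨l', by simp at h3; rw [h3]⟩
      exact List.isChain_cons_cons.2 ⟨⟨(), trivial, hs⟩, h2⟩
    · intro x hx
      rcases List.mem_cons.1 hx with rfl | hx
      · exact Reaches.refl x
      · exact (reaches_of_mem_step hs).trans (h5 x hx)

/-- From each initial state, the paths of all lengths at least `m` end in one common state. -/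
theorem accepts_iff_of_loop (h : A.IsPtNFA) {m j : ℕ}
    (hm : ∀ j, m ≤ j → ∀ p ∈ A.start, ∀ q, A.ReachesIn j p q → q ∈ A.step q ()) (hj : m ≤ j) :
    List.replicate j () ∈ A.accepts ↔ List.replicate m () ∈ A.accepts := by
  simp only [replicate_mem_accepts_iff]
  constructor
  · rintro ⟨p, hp, q, hq, hpq⟩
    obtain ⟨r, hr⟩ := h.exists_reachesIn m p
    rw [← h.eq_of_reachesIn_of_loop hpq hr (hm j hj p hp q hpq) (hm m le_rfl p hp r hr)] at hq
    exact ⟨p, hp, r, hq, hr⟩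
  · rintro ⟨p, hp, q, hq, hpq⟩
    obtain ⟨r, hr⟩ := h.exists_reachesIn j p
    rw [← h.eq_of_reachesIn_of_loop hpq hr (hm m le_rfl p hp q hpq) (hm j hj p hp r hr)] at hq
    exact ⟨p, hp, r, hq, hr⟩

variable [Fintype σ]

theorem loop_of_card_le (h : A.IsPtNFA) {j : ℕ} {p q : σ} (hpq : A.ReachesIn j p q)
    (hj : Fintype.card σ ≤ j + 1) : q ∈ A.step q () := by
  by_contra hq
  obtain ⟨r, hr⟩ := h.2.1 q ()
  obtain ⟨l, h1, _, _, h2, _⟩ := h.exists_simple_path hpq hq hr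
  have := h1.length_le_card
  omega

theorem loop_of_depth_le (h : A.IsPtNFA) {j : ℕ} {p q : σ} (hp : p ∈ A.start)
    (hpq : A.ReachesIn j p q) (hj : A.depth ≤ j) : q ∈ A.step q () := by
  by_contra hq
  obtain ⟨r, hr⟩ := h.2.1 q ()
  obtain ⟨l, h1, h2, h3, h4, _⟩ := h.exists_simple_path hpq hq hr
  -- `depth` is an `sSup` in `ℕ`, whose members are known to lie below it only if the set is
  -- bounded.
  have hbdd : BddAbove {m | ∃ l : List σ, l.Nodup ∧ l.IsChain (A.GraphEdge Set.univ) ∧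
      (∃ q ∈ A.start, l.head? = some q) ∧ l.length = m + 1} := by
    refine ⟨Fintype.card σ, ?_⟩
    rintro m ⟨l, hl, _, _, hm⟩
    have := hl.length_le_card
    omega
  have : j + 1 ≤ A.depth := le_csSup hbdd ⟨l, h1, h2, ⟨p, hp, h3⟩, h4⟩
  omega

theorem isKPiecewiseTestable_iff_of_depth_le (h : A.IsPtNFA) (k : ℕ) :
    IsKPiecewiseTestable k A.accepts ↔ ∀ j, k < j → j ≤ A.depth →
      (List.replicate j () ∈ A.accepts ↔ List.replicate k () ∈ A.accepts) := by
  rw [isKPiecewiseTestable_unit_iff]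
  refine ⟨fun hk j hj _ => hk j hj, fun hk j hj => ?_⟩
  have hd : ∀ j, A.depth ≤ j →
      (List.replicate j () ∈ A.accepts ↔ List.replicate A.depth () ∈ A.accepts) := fun j hj =>
    h.accepts_iff_of_loop (fun j hj p hp q hpq => h.loop_of_depth_le hp hpq hj) hj
  rcases le_or_gt j A.depth with h1 | h1
  · exact hk j hj h1
  rcases lt_or_ge k A.depth with h2 | h2
  · rw [hd j h1.le, hk A.depth h2 le_rfl]
  · rw [hd j h1.le, hd k h2]

/-- It suffices to compare the acceptance of the words of lengths `min k m, …, min k m + m` if `m`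
is at least the number of states. -/
theorem isKPiecewiseTestable_iff_of_card_le (h : A.IsPtNFA) (k : ℕ) {m : ℕ}
    (hm : Fintype.card σ ≤ m) :
    IsKPiecewiseTestable k A.accepts ↔ ∀ i < m, (List.replicate (min k m + (i + 1)) () ∈ A.accepts ↔
      List.replicate (min k m) () ∈ A.accepts) := by
  rw [isKPiecewiseTestable_unit_iff]
  have hd : ∀ j, m ≤ j →
      (List.replicate j () ∈ A.accepts ↔ List.replicate m () ∈ A.accepts) := fun j hj =>
    h.accepts_iff_of_loop (fun j hj p _ q hpq => h.loop_of_card_le hpq (by omega)) hj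
  rcases le_or_gt m k with h1 | h1
  · rw [min_eq_right h1]
    refine iff_of_true (fun j hj => ?_) (fun i _ => hd _ (by omega))
    rw [hd j (by omega), hd k h1]
  · rw [min_eq_left h1.le]
    refine ⟨fun hk i _ => hk _ (by omega), fun hk j hj => ?_⟩
    rcases le_or_gt j (k + m) with h2 | h2
    · have := hk (j - k - 1) (by omega)
      rwa [show k + (j - k - 1 + 1) = j by omega] at this
    -- The last word compared has length `k + m ≥ m`, so it represents all longer ones.
    · have := hk (m - 1) (by omega)
      rw [show k + (m - 1 + 1) = k + m by omega, hd (k + m) (by omega)] at this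
      rw [hd j (by omega), this]

end IsPtNFA

/-- An automaton is a ptNFA if and only if its long paths from any fixed state all lead to the same
state, regardless of their lengths. -/
theorem isPtNFA_iff [Fintype σ] {m : ℕ} (hm : Fintype.card σ ≤ m) :
    A.IsPtNFA ↔ ∀ p, ∃ s, (∀ q, A.ReachesIn m p q ↔ q = s) ∧
      ∀ q, A.ReachesIn (m + 1) p q ↔ q = s := by
  constructor
  · intro h p
    obtain ⟨s, hs⟩ := h.exists_reachesIn m p
    have hs' := h.loop_of_card_le hs (by omega)
    refine ⟨s, fun q => ⟨fun hq => ?_, ?_⟩, fun q => ⟨fun hq => ?_, ?_⟩⟩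
    · exact h.eq_of_reachesIn_of_loop hs hq hs' (h.loop_of_card_le hq (by omega))
    · rintro rfl; exact hs
    · exact h.eq_of_reachesIn_of_loop hs hq hs' (h.loop_of_card_le hq (by omega))
    · rintro rfl
      exact reachesIn_add.2 ⟨_, hs, reachesIn_one.2 hs'⟩
  · intro h
    choose f hf hf' using h
    -- The singleton `{f p}` is reached after `m` and after `m + 1` steps, so it is mapped to
    -- itself.
    have hstep : ∀ p q, q ∈ A.step (f p) () ↔ q = f p := by
      intro p q
      rw [← hf' p q, reachesIn_add]
      simp [hf, reachesIn_one]
    have hlong : ∀ p i q, A.ReachesIn (m + i) p q ↔ q = f p := by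
      intro p i
      induction i with
      | zero => exact hf p
      | succ i ih =>
        intro q
        rw [← add_assoc, reachesIn_add]
        simp [ih, reachesIn_one, hstep]
    have hloop : ∀ p, A.ReachesIn m p p → ∀ q, q ∈ A.step p () ↔ q = p := by
      intro p hp q
      have := hstep p q
      rwa [← (hf p p).1 hp] at this
    have hfix : ∀ p, (∀ q, q ∈ A.step p () ↔ q = p) → ∀ i q, A.ReachesIn i p q → q = p := by
      intro p hp i
      induction i with
      | zero => exact fun q hq => hq
      | succ i ih =>
        intro q hq
        obtain ⟨r, hr, hq⟩ := reachesIn_succ.1 hq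
        rw [(hp r).1 hr] at hq
        exact ih q hq
    have hstay : ∀ p, p ∈ A.step p () → ∀ i, A.ReachesIn i p p := by
      intro p hp i
      induction i with
      | zero => rfl
      | succ i ih => exact reachesIn_succ.2 ⟨p, hp, ih⟩
    have hself : ∀ p, p ∈ A.step p () → ∀ q, q ∈ A.step p () ↔ q = p :=
      fun p hp => hloop p (hstay p hp m)
    refine ⟨{ refl := Reaches.refl, trans := fun _ _ _ => Reaches.trans, antisymm := ?_ }, ?_, ?_⟩
    · intro p q hpq hqp
      obtain ⟨i, hi⟩ := reaches_iff_exists_reachesIn.1 hpq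
      obtain ⟨j, hj⟩ := reaches_iff_exists_reachesIn.1 hqp
      by_cases h0 : i + j = 0
      · have : i = 0 := by omega
        subst this
        exact (reachesIn_zero.1 hi).symm
      -- Run `m` times, a closed walk of positive length through `p` has length at least `m` and so
      -- ends in `f p`. Thus `p = f p` has no other successor, and `q = p`.
      have hcycle : ∀ c, A.ReachesIn (c * (i + j)) p p := by
        intro c
        induction c with
        | zero => rw [zero_mul]; rfl
        | succ c ih =>
          rw [Nat.succ_mul]
          exact reachesIn_add.2 ⟨p, ih, reachesIn_add.2 ⟨q, hi, hj⟩⟩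
      have hp : p = f p := by
        rw [← hlong p (m * (i + j) - m) p,
          Nat.add_sub_cancel' (Nat.le_mul_of_pos_right m (by omega))]
        exact hcycle m
      exact (hfix p (hloop p ((hf p p).2 hp)) i q hi).symm
    · rintro p ⟨⟩
      obtain ⟨r, hr, _⟩ := reachesIn_succ.1 ((hf' p (f p)).2 rfl)
      exact ⟨r, hr⟩
    · intro p q hpq
      by_cases hp : p ∈ A.step p ()
      · have hfp : f p = p := ((hf p p).1 (hstay p hp m)).symm
        -- A path of length `m` from `b` is the rest of one of length `m + 1` from `a`. So `f` is
        -- constant on components, and a maximal `q` equals `f q = f p = p`.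
        have hedge : ∀ a b, b ∈ A.step a () → f a = f b := by
          intro a b hab
          exact ((hf' a (f b)).1 (reachesIn_succ.2 ⟨b, hab, (hf b (f b)).2 rfl⟩)).symm
        have hcomp : ∀ a b, Relation.EqvGen (A.GraphEdge (A.loopLetters p)) a b → f a = f b := by
          intro a b hab
          induction hab with
          | rel a b hab => exact hedge a b ((graphEdge_loopLetters_iff hp).1 hab)
          | refl a => rfl
          | symm a b _ ih => exact ih.symm
          | trans a b c _ _ ih ih' => exact ih.trans ih'
        constructor
        · intro hq
          have := hq (f q) (ReachesIn.reflTransGen hp ((hf q (f q)).2 rfl))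
          rw [← this, ← hcomp p q hpq, hfp]
        · rintro rfl r hr
          induction hr with
          | refl => rfl
          | tail _ hab ih =>
            subst ih
            exact (hself _ hp _).1 ((graphEdge_loopLetters_iff hp).1 hab)
      · have hno : ∀ a b, ¬ A.GraphEdge (A.loopLetters p) a b := by
          rintro a b ⟨c, hc, _⟩
          exact hp hc
        have hcomp : ∀ a b, Relation.EqvGen (A.GraphEdge (A.loopLetters p)) a b → a = b := by
          intro a b hab
          induction hab with
          | rel a b hab => exact (hno a b hab).elim
          | refl a => rfl
          | symm a b _ ih => exact ih.symm
          | trans a b c _ _ ih ih' => exact ih.trans ih'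
        constructor
        · exact fun _ => (hcomp p q hpq).symm
        · rintro rfl r hr
          rcases hr.cases_head with h1 | ⟨c, hc, _⟩
          · exact h1.symm
          · exact (hno _ _ hc).elim

end NFA

/-! ### Loop programs on stacks and their compilation to Turing machines -/

open Turing

/-- Structured programs that work on stacks, indexed by `W`, of symbols from `Γ` and on a register
with values in `σ`. The only loops are `loop d p`, which repeat their body as many times as the
input has symbols; `d` names the clock that counts the repetitions. -/
inductive LoopProgram (W σ Γ : Type) (D : ℕ) : Type
  | push : W → (σ → Γ) → LoopProgram W σ Γ D
  | pop : W → (σ → Option Γ → σ) → LoopProgram W σ Γ D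
  | load : (σ → σ) → LoopProgram W σ Γ D
  | seq : LoopProgram W σ Γ D → LoopProgram W σ Γ D → LoopProgram W σ Γ D
  | ite : (σ → Bool) → LoopProgram W σ Γ D → LoopProgram W σ Γ D → LoopProgram W σ Γ D
  | loop : Fin D → LoopProgram W σ Γ D → LoopProgram W σ Γ D

namespace LoopProgram

variable {W σ Γ : Type} {D : ℕ}

/-- All clocks of the program have an index below `m`, and nested loops have different clocks. -/
def Below : ℕ → LoopProgram W σ Γ D → Prop
  | _, push _ _ => True
  | _, pop _ _ => True
  | _, load _ => True
  | m, seq p q => p.Below m ∧ q.Below m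
  | m, ite _ p q => p.Below m ∧ q.Below m
  | m, loop d p => d.val < m ∧ p.Below d.val

/-- The effect of a program if its loops are repeated `n` times. -/
def eval [DecidableEq W] (n : ℕ) : LoopProgram W σ Γ D → σ × (W → List Γ) → σ × (W → List Γ)
  | push k f, s => (s.1, Function.update s.2 k (f s.1 :: s.2 k))
  | pop k f, s => (f s.1 (s.2 k).head?, Function.update s.2 k (s.2 k).tail)
  | load f, s => (f s.1, s.2)
  | seq p q, s => q.eval n (p.eval n s)
  | ite c p q, s => if c s.1 then p.eval n s else q.eval n s
  | loop _ p, s => (p.eval n)^[n] s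

/-- A bound for the running time of the compiled program, as a polynomial in the number of
repetitions of the loops. -/
noncomputable def cost : LoopProgram W σ Γ D → Polynomial ℕ
  | push _ _ => 1
  | pop _ _ => 1
  | load _ => 1
  | seq p q => p.cost + q.cost
  | ite _ p q => 1 + p.cost + q.cost
  | loop _ p => Polynomial.X * p.cost + 2 * Polynomial.X + 2

/-- A primitive instruction adds at most one symbol. The bound limits the time needed to clear the
stacks at the end. -/
theorem length_eval_le [DecidableEq W] (n : ℕ) (p : LoopProgram W σ Γ D) (k : W) :
    ∀ s : σ × (W → List Γ),
      ((p.eval n s).2 k).length ≤ (s.2 k).length + p.cost.eval n := by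
  induction p with
  | push k' f =>
    intro s
    by_cases h : k = k'
    · subst h; simp [eval, cost]
    · simp [eval, cost, Function.update_of_ne h]
  | pop k' f =>
    intro s
    by_cases h : k = k'
    · subst h; simp [eval, cost]; omega
    · simp [eval, cost, Function.update_of_ne h]
  | load f => intro s; simp [eval, cost]
  | seq p q hp hq =>
    intro s
    have h1 := hp s
    have h2 := hq (p.eval n s)
    simp only [eval, cost, Polynomial.eval_add]
    omega
  | ite c p q hp hq =>
    intro s
    have h1 := hp s
    have h2 := hq s
    simp only [eval, cost, Polynomial.eval_add]
    split_ifs <;> omega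
  | loop d p hp =>
    intro s
    have h : ∀ m, (((p.eval n)^[m] s).2 k).length ≤ (s.2 k).length + m * p.cost.eval n := by
      intro m
      induction m with
      | zero => simp
      | succ m ih =>
        rw [Function.iterate_succ_apply']
        have := hp ((p.eval n)^[m] s)
        rw [Nat.succ_mul]
        omega
    have := h n
    simp only [eval, cost, Polynomial.eval_add, Polynomial.eval_mul, Polynomial.eval_X]
    omega

/-! #### Compilation -/

/-- The stacks of the compiled machine: an output stack, the stacks of the program, and two stacks
for each clock. -/
abbrev Stack (W : Type) (D : ℕ) : Type := Option (W ⊕ (Fin D × Bool))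

/-- The alphabets of the stacks of the compiled machine. -/
abbrev StackSymbol (W Γ : Type) (D : ℕ) : Stack W D → Type
  | none => Bool
  | some _ => Γ

/-- The statements of the compiled machine. Its internal state consists of the symbol read last and
of the register. -/
abbrev MachineStmt (W σ Γ : Type) (D : ℕ) (Λ : Type) : Type :=
  TM2.Stmt (StackSymbol W Γ D) Λ (Option Γ × σ)

/-- The labels of the compiled program. -/
@[reducible] def Label : LoopProgram W σ Γ D → Type
  | push _ _ => Unit
  | pop _ _ => Unit
  | load _ => Unit
  | seq p q => p.Label ⊕ q.Label
  | ite _ p q => Option (p.Label ⊕ q.Label)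
  | loop _ p => Bool ⊕ p.Label

noncomputable instance fintypeLabel : (p : LoopProgram W σ Γ D) → Fintype p.Label
  | push _ _ => inferInstanceAs (Fintype Unit)
  | pop _ _ => inferInstanceAs (Fintype Unit)
  | load _ => inferInstanceAs (Fintype Unit)
  | seq p q =>
    haveI := fintypeLabel p
    haveI := fintypeLabel q
    inferInstanceAs (Fintype (p.Label ⊕ q.Label))
  | ite _ p q =>
    haveI := fintypeLabel p
    haveI := fintypeLabel q
    inferInstanceAs (Fintype (Option (p.Label ⊕ q.Label)))
  | loop _ p =>
    haveI := fintypeLabel p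
    inferInstanceAs (Fintype (Bool ⊕ p.Label))

/-- The label at which the compiled program is entered. -/
def entry : (p : LoopProgram W σ Γ D) → p.Label
  | push _ _ => ()
  | pop _ _ => ()
  | load _ => ()
  | seq p _ => Sum.inl p.entry
  | ite _ _ _ => none
  | loop _ _ => Sum.inl false

/-- The statements of the compiled program, in a machine in which its labels are embedded by `e` and
in which it is left to the label `x`. -/
def code [Inhabited Γ] {Λ : Type} :
    (p : LoopProgram W σ Γ D) → (p.Label → Λ) → Λ → p.Label → MachineStmt W σ Γ D Λ
  | push k f, _, x, _ => .push (some (.inl k)) (fun v => f v.2) (.goto fun _ => x)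
  | pop k f, _, x, _ => .pop (some (.inl k)) (fun v a => (v.1, f v.2 a)) (.goto fun _ => x)
  | load f, _, x, _ => .load (fun v => (v.1, f v.2)) (.goto fun _ => x)
  | seq p q, e, _, .inl l => p.code (fun l => e (.inl l)) (e (.inr q.entry)) l
  | seq _ q, e, x, .inr l => q.code (fun l => e (.inr l)) x l
  | ite c p q, e, _, none => .branch (fun v => c v.2)
      (.goto fun _ => e (some (.inl p.entry))) (.goto fun _ => e (some (.inr q.entry)))
  | ite _ p _, e, x, some (.inl l) => p.code (fun l => e (some (.inl l))) x l
  | ite _ _ q, e, x, some (.inr l) => q.code (fun l => e (some (.inr l))) x l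
  | loop d p, e, _, .inl false => .pop (some (.inr (d, false))) (fun v a => (a, v.2))
      (.branch (fun v => v.1.isSome)
        (.push (some (.inr (d, true))) (fun _ => default)
          (.load (fun v => (none, v.2)) (.goto fun _ => e (.inr p.entry))))
        (.goto fun _ => e (.inl true)))
  | loop d _, e, x, .inl true => .pop (some (.inr (d, true))) (fun v a => (a, v.2))
      (.branch (fun v => v.1.isSome)
        (.push (some (.inr (d, false))) (fun _ => default)
          (.load (fun v => (none, v.2)) (.goto fun _ => e (.inl true))))
        (.goto fun _ => x))
  | loop _ p, e, _, .inr l => p.code (fun l => e (.inr l)) (e (.inl false)) l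

/-- The contents of the stacks of the compiled machine, given the contents of the stacks of the
program and the numbers of symbols on the stacks of the clocks. -/
def contents [Inhabited Γ] (s : W → List Γ) (c : Fin D × Bool → ℕ) :
    ∀ k : Stack W D, List (StackSymbol W Γ D k)
  | none => []
  | some (.inl k) => s k
  | some (.inr i) => List.replicate (c i) default

section

variable [DecidableEq W] [Inhabited Γ]

theorem update_contents_work (s : W → List Γ) (c : Fin D × Bool → ℕ) (k : W) (l : List Γ) :
    Function.update (contents s c) (some (.inl k)) l = contents (Function.update s k l) c := by
  funext i
  match i with
  | none => rfl
  | some (.inr i) => rfl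
  | some (.inl k') =>
    by_cases h : k' = k
    · subst h; simp [contents]
    · rw [Function.update_of_ne (by simpa using h)]
      simp [contents, Function.update_of_ne h]

theorem update_contents_clock (s : W → List Γ) (c : Fin D × Bool → ℕ) (i : Fin D × Bool)
    (l : List Γ)
    (m : ℕ) (hl : l = List.replicate m default) :
    Function.update (contents s c) (some (.inr i)) l = contents s (Function.update c i m) := by
  funext k
  match k with
  | none => rfl
  | some (.inl k) => rfl
  | some (.inr j) =>
    by_cases h : j = i
    · subst h; simp [contents, hl]
    · rw [Function.update_of_ne (by simpa using h)]
      simp [contents, Function.update_of_ne h]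

end

/-! ### Step counts and correctness of the compiled code -/

/-- The machine `M` gets from the configuration `a` to `b` in at most `T` steps. -/
def ReachesIn {K : Type} [DecidableEq K] {G : K → Type} {Λ τ : Type} (M : Λ → TM2.Stmt G Λ τ)
    (a : TM2.Cfg G Λ τ) (T : ℕ) (b : TM2.Cfg G Λ τ) : Prop :=
  ∃ t ≤ T, (flip bind (TM2.step M))^[t] (some a) = some b

namespace ReachesIn

variable {K : Type} [DecidableEq K] {G : K → Type} {Λ τ : Type} {M : Λ → TM2.Stmt G Λ τ}
  {a b c : TM2.Cfg G Λ τ} {T U : ℕ}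

theorem refl : ReachesIn M a T a := ⟨0, Nat.zero_le _, rfl⟩

theorem single {l : Λ} {v : τ} {S : ∀ k, List (G k)} :
    ReachesIn M ⟨some l, v, S⟩ 1 (TM2.stepAux (M l) v S) := ⟨1, le_rfl, rfl⟩

theorem trans (h : ReachesIn M a T b) (h' : ReachesIn M b U c) : ReachesIn M a (T + U) c := by
  obtain ⟨t, ht, h⟩ := h
  obtain ⟨u, hu, h'⟩ := h'
  exact ⟨u + t, by omega, by rw [Function.iterate_add_apply, h, h']⟩

theorem mono (h : ReachesIn M a T b) (hTU : T ≤ U) : ReachesIn M a U b := by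
  obtain ⟨t, ht, h⟩ := h
  exact ⟨t, ht.trans hTU, h⟩

theorem head {l : Λ} {v : τ} {S : ∀ k, List (G k)} (h : TM2.stepAux (M l) v S = b)
    (h' : ReachesIn M b T c) : ReachesIn M ⟨some l, v, S⟩ (T + 1) c := by
  subst h
  exact (single.trans h').mono (by omega)

end ReachesIn

variable [DecidableEq W] [Inhabited Γ] {Λ : Type}

/-- A loop consumes its clock by shifting symbols from the `false` stack to the `true` stack;
shifting them back makes the clock reusable. -/
theorem reachesIn_clock_reset (M : Λ → MachineStmt W σ Γ D Λ) (d : Fin D) (p : LoopProgram W σ Γ D)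
    (e : (loop d p).Label → Λ) (x : Λ) (hM : ∀ l, M (e l) = (loop d p).code e x l) (v : σ)
    (s : W → List Γ) : ∀ (i j : ℕ) (c : Fin D × Bool → ℕ), c (d, true) = i → c (d, false) = j →
      ReachesIn M ⟨some (e (.inl true)), (none, v), contents s c⟩ (i + 1)
        ⟨some x, (none, v),
          contents s (Function.update (Function.update c (d, true) 0) (d, false) (i + j))⟩ := by
  intro i
  induction i with
  | zero =>
    intro j c hi hj
    refine ReachesIn.head (b := ⟨some x, (none, v), contents s c⟩) ?_ ?_
    · rw [hM]
      simp only [code, TM2.stepAux]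
      rw [update_contents_clock s c (d, true) _ 0 (by simp [contents, hi])]
      have : Function.update c (d, true) 0 = c := by rw [← hi, Function.update_eq_self]
      simp [contents, hi, this]
    · have : Function.update (Function.update c (d, true) 0) (d, false) (0 + j) = c := by
        rw [← hi, Function.update_eq_self, hi, zero_add, ← hj, Function.update_eq_self]
      rw [this]
      exact ReachesIn.refl
  | succ i ih =>
    intro j c hi hj
    set c' := Function.update (Function.update c (d, true) i) (d, false) (j + 1) with hc'
    refine ReachesIn.head (b := ⟨some (e (.inl true)), (none, v), contents s c'⟩) ?_ ?_
    · rw [hM]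
      simp only [code, TM2.stepAux]
      rw [update_contents_clock s c (d, true) _ i (by simp [contents, hi])]
      have h1 : (contents s c (some (.inr (d, true)))).head? = some (default : Γ) := by
        simp [contents, hi, List.replicate_succ]
      rw [h1]
      simp only [Option.isSome_some, cond_true]
      rw [update_contents_clock s _ (d, false) _ (j + 1)
        (by simp [contents, hj, List.replicate_succ])]
    · have := ih (j + 1) c' (by simp [hc']) (by simp [hc'])
      have h2 : Function.update (Function.update c' (d, true) 0) (d, false) (i + (j + 1)) =
          Function.update (Function.update c (d, true) 0) (d, false) (i + 1 + j) := ?_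
      · rwa [h2] at this
      funext y
      by_cases h1 : y = (d, false)
      · subst h1; simp; omega
      · by_cases h2 : y = (d, true)
        · subst h2; simp
        · simp [hc', Function.update_of_ne h1, Function.update_of_ne h2]

/-- The clocks below `m` are full on entry, and all clocks have their old contents on exit. So
consecutive loops can share a clock, while a nested loop needs a smaller one, since the clock of the
enclosing loop is partly used. -/
theorem reachesIn_code (M : Λ → MachineStmt W σ Γ D Λ) (n : ℕ) (p : LoopProgram W σ Γ D) :
    ∀ (m : ℕ), p.Below m → ∀ (e : p.Label → Λ) (x : Λ), (∀ l, M (e l) = p.code e x l) →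
      ∀ (s : σ × (W → List Γ)) (c : Fin D × Bool → ℕ),
        (∀ d : Fin D, d.val < m → c (d, false) = n ∧ c (d, true) = 0) →
        ReachesIn M ⟨some (e p.entry), (none, s.1), contents s.2 c⟩ (p.cost.eval n)
          ⟨some x, (none, (p.eval n s).1), contents (p.eval n s).2 c⟩ := by
  induction p with
  | push k f =>
    intro m _ e x hM s c _
    refine (ReachesIn.head (T := 0) ?_ ReachesIn.refl).mono (by simp [cost])
    rw [hM]
    simp only [code, TM2.stepAux]
    rw [update_contents_work]
    rfl
  | pop k f =>
    intro m _ e x hM s c _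
    refine (ReachesIn.head (T := 0) ?_ ReachesIn.refl).mono (by simp [cost])
    rw [hM]
    simp only [code, TM2.stepAux]
    rw [update_contents_work]
    rfl
  | load f =>
    intro m _ e x hM s c _
    refine (ReachesIn.head (T := 0) ?_ ReachesIn.refl).mono (by simp [cost])
    rw [hM]
    rfl
  | seq p q hp hq =>
    intro m hb e x hM s c hc
    have h1 := hp m hb.1 (fun l => e (.inl l)) (e (.inr q.entry))
      (fun l => hM _) s c hc
    have h2 := hq m hb.2 (fun l => e (.inr l)) x (fun l => hM _) (p.eval n s) c hc
    simp only [cost, Polynomial.eval_add]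
    exact h1.trans h2
  | ite t p q hp hq =>
    intro m hb e x hM s c hc
    have h1 := hp m hb.1 (fun l => e (some (.inl l))) x (fun l => hM _) s c hc
    have h2 := hq m hb.2 (fun l => e (some (.inr l))) x (fun l => hM _) s c hc
    simp only [cost, Polynomial.eval_add, Polynomial.eval_one]
    by_cases ht : t s.1 = true
    · have he : (ite t p q).eval n s = p.eval n s := by simp [eval, ht]
      rw [he]
      refine (ReachesIn.head ?_ h1).mono (by omega)
      change TM2.stepAux (M (e none)) _ _ = _
      rw [hM]
      simp [code, ht]
    · have he : (ite t p q).eval n s = q.eval n s := by simp [eval, ht]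
      rw [he]
      refine (ReachesIn.head ?_ h2).mono (by omega)
      change TM2.stepAux (M (e none)) _ _ = _
      rw [hM]
      simp [code, ht]
  | loop d p hp =>
    intro m hb e x hM s c hc
    -- Generalised to a loop in progress: `j` symbols are left on the clock and `i` have been
    -- shifted.
    have hrun : ∀ (j i : ℕ) (s : σ × (W → List Γ)) (c : Fin D × Bool → ℕ),
        (∀ d' : Fin D, d'.val < d.val → c (d', false) = n ∧ c (d', true) = 0) →
        c (d, false) = j → c (d, true) = i →
        ReachesIn M ⟨some (e (.inl false)), (none, s.1), contents s.2 c⟩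
          (j * (p.cost.eval n + 1) + 1)
          ⟨some (e (.inl true)), (none, ((p.eval n)^[j] s).1), contents ((p.eval n)^[j] s).2
            (Function.update (Function.update c (d, false) 0) (d, true) (j + i))⟩ := by
      intro j
      induction j with
      | zero =>
        intro i s c _ hj hi
        refine (ReachesIn.head (T := 0) ?_ ReachesIn.refl).mono (by omega)
        rw [hM]
        simp only [code, TM2.stepAux]
        rw [update_contents_clock s.2 c (d, false) _ 0 (by simp [contents, hj])]
        have h1 : (contents s.2 c (some (.inr (d, false)))).head? = (none : Option Γ) := by
          simp [contents, hj]
        have h2 : Function.update (Function.update c (d, false) 0) (d, true) (0 + i) =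
            Function.update c (d, false) 0 := by
          rw [zero_add, Function.update_eq_self_iff]
          simp [hi]
        rw [h1, h2]
        simp
      | succ j ih =>
        intro i s c hc hj hi
        set c' := Function.update (Function.update c (d, false) j) (d, true) (i + 1) with hc'
        have hlow : ∀ d' : Fin D, d'.val < d.val → c' (d', false) = n ∧ c' (d', true) = 0 := by
          intro d' hd'
          have hne : d' ≠ d := fun h => by simp [h] at hd'
          simpa [hc', Function.update_apply, hne] using hc d' hd'
        have h1 := hp d.val hb.2 (fun l => e (.inr l)) (e (.inl false))
          (fun l => hM _) s c' hlow
        have h2 := ih (i + 1) (p.eval n s) c' hlow (by simp [hc'])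
          (by simp [hc'])
        have h3 : Function.update (Function.update c' (d, false) 0) (d, true) (j + (i + 1)) =
            Function.update (Function.update c (d, false) 0) (d, true) (j + 1 + i) := by
          funext y
          by_cases g1 : y = (d, false)
          · subst g1; simp
          · by_cases g2 : y = (d, true)
            · subst g2; simp; omega
            · simp [hc', Function.update_of_ne g1, Function.update_of_ne g2]
        rw [h3, ← Function.iterate_succ_apply] at h2
        refine (ReachesIn.head ?_ (h1.trans h2)).mono (by rw [Nat.succ_mul]; omega)
        rw [hM]
        simp only [code, TM2.stepAux]
        rw [update_contents_clock s.2 c (d, false) _ j (by simp [contents, hj])]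
        have h4 : (contents s.2 c (some (.inr (d, false)))).head? = some (default : Γ) := by
          simp [contents, hj, List.replicate_succ]
        rw [h4]
        simp only [Option.isSome_some, cond_true]
        rw [update_contents_clock s.2 _ (d, true) _ (i + 1)
          (by simp [contents, hi, List.replicate_succ])]
    have hd := hc d hb.1
    have h1 := hrun n 0 s c (fun d' hd' => hc d' (hd'.trans hb.1)) hd.1 hd.2
    have h2 := reachesIn_clock_reset M d p e x hM ((p.eval n)^[n] s).1 ((p.eval n)^[n] s).2 n 0
      (Function.update (Function.update c (d, false) 0) (d, true) (n + 0))
      (by simp) (by simp)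
    have h3 : Function.update (Function.update (Function.update (Function.update c (d, false) 0)
        (d, true) (n + 0)) (d, true) 0) (d, false) (n + 0) = c := by
      funext y
      by_cases g1 : y = (d, false)
      · subst g1; simp [hd.1]
      · by_cases g2 : y = (d, true)
        · subst g2; simp [hd.2]
        · simp [Function.update_of_ne g1, Function.update_of_ne g2]
    rw [h3] at h2
    -- The iterations take `n * (cost + 1) + 1` steps and the reset of the clock `n + 1`.
    refine (h1.trans h2).mono ?_
    simp only [cost, Polynomial.eval_add, Polynomial.eval_mul, Polynomial.eval_X,
      Polynomial.eval_ofNat]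
    ring_nf
    omega

end LoopProgram

/-! ### Input, clean-up and output of the machine -/

namespace LoopProgram

variable {W σ Γ : Type} {D : ℕ}

/-- Push a symbol on the first stack of every clock in the list. -/
def pushClocks [Inhabited Γ] {Λ : Type} (L : List (Fin D)) (q : MachineStmt W σ Γ D Λ) :
    MachineStmt W σ Γ D Λ :=
  L.foldr (fun d q => .push (some (.inr (d, false))) (fun _ => default) q) q

/-- Pop all stacks in the list, and remember whether one of them was nonempty. -/
def popAll {Λ : Type} (L : List (W ⊕ (Fin D × Bool))) (q : MachineStmt W σ Γ D Λ) :
    MachineStmt W σ Γ D Λ :=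
  L.foldr (fun k q => .pop (some k) (fun v a => (v.1.or a, v.2)) q) q

/-- The statements of a machine that reverses the input from the stack `i` to the stack `t` and
fills the clocks, runs the program `p`, clears all stacks and outputs the answer. -/
noncomputable def machineCode [Inhabited Γ] [Fintype W] (p : LoopProgram W σ Γ D) (i t : W) (v₀ : σ)
    (ans : σ → Bool) : Bool ⊕ p.Label → MachineStmt W σ Γ D (Bool ⊕ p.Label)
  | .inl false => .pop (some (.inl i)) (fun v a => (a, v.2))
      (.branch (fun v => v.1.isSome)
        (.push (some (.inl t)) (fun v => v.1.getD default)
          (pushClocks (List.finRange D)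
            (.load (fun v => (none, v.2)) (.goto fun _ => .inl false))))
        (.goto fun _ => .inr p.entry))
  | .inl true => .load (fun v => (none, v.2)) (popAll Finset.univ.toList
      (.branch (fun v => v.1.isSome)
        (.goto fun _ => .inl true)
        (.push none (fun v => ans v.2) (.load (fun _ => (none, v₀)) .halt))))
  | .inr l => p.code .inr (.inl true) l

/-- The Turing machine that executes the program `p`. -/
noncomputable def machine [DecidableEq W] [Inhabited Γ] [Fintype W] [Fintype Γ] [Fintype σ]
    (p : LoopProgram W σ Γ D) (i t : W) (v₀ : σ) (ans : σ → Bool) : FinTM2 where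
  K := Stack W D
  k₀ := some (.inl i)
  k₁ := none
  Γ := StackSymbol W Γ D
  Λ := Bool ⊕ p.Label
  main := .inl false
  σ := Option Γ × σ
  initialState := (none, v₀)
  Γk₀Fin := inferInstanceAs (Fintype Γ)
  m := machineCode p i t v₀ ans

variable [DecidableEq W]

/-- The flag is the disjunction of all symbols popped, so it is empty exactly when there was nothing
left to clear. -/
theorem stepAux_popAll {Λ : Type} (q : MachineStmt W σ Γ D Λ) (L : List (W ⊕ (Fin D × Bool)))
    (hL : L.Nodup) : ∀ (v : Option Γ × σ) (S : ∀ k : Stack W D, List (StackSymbol W Γ D k)),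
      ∃ a : Option Γ, ∃ S' : ∀ k : Stack W D, List (StackSymbol W Γ D k),
        TM2.stepAux (popAll L q) v S = TM2.stepAux q (a, v.2) S' ∧
        (a = none ↔ v.1 = none ∧ ∀ k ∈ L, S (some k) = []) ∧ S' none = S none ∧
        ∀ k, (k ∈ L → S' (some k) = (S (some k)).tail) ∧ (k ∉ L → S' (some k) = S (some k)) := by
  induction L with
  | nil =>
    intro v S
    exact ⟨v.1, S, rfl, by simp, rfl, by simp⟩
  | cons k L ih =>
    intro v S
    obtain ⟨hk, hL⟩ := List.nodup_cons.1 hL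
    obtain ⟨a, S', h1, h2, h3, h4⟩ := ih hL (v.1.or (S (some k)).head?, v.2)
      (Function.update S (some k) (S (some k)).tail)
    refine ⟨a, S', h1, ?_, by rw [h3]; rfl, ?_⟩
    · have : (∀ k' ∈ L, Function.update S (some k) (S (some k)).tail (some k') = []) ↔
          ∀ k' ∈ L, S (some k') = [] := by
        refine forall₂_congr fun k' hk' => ?_
        rw [Function.update_of_ne (by rintro h; cases h; exact hk hk')]
      rw [h2, this]
      simp [List.head?_eq_none_iff, and_assoc]
    · intro k'
      have h5 := h4 k'
      by_cases h : k' = k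
      · subst h; simpa [hk] using h5
      · rw [Function.update_of_ne (by simpa using h)] at h5
        simpa [h] using h5

variable [Inhabited Γ]

theorem stepAux_pushClocks {Λ : Type} (q : MachineStmt W σ Γ D Λ) (v : Option Γ × σ)
    (s : W → List Γ) (L : List (Fin D)) : ∀ c : Fin D × Bool → ℕ,
      TM2.stepAux (pushClocks L q) v (contents s c) = TM2.stepAux q v
        (contents s fun i => c i + if i.2 then 0 else L.count i.1) := by
  induction L with
  | nil => intro c; simp [pushClocks]
  | cons d L ih =>
    intro c
    change TM2.stepAux (pushClocks L q) v (Function.update _ _ _) = _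
    rw [update_contents_clock s c (d, false) _ (c (d, false) + 1)
      (by simp [contents, List.replicate_succ]), ih]
    congr 2
    funext ⟨d', b⟩
    cases b
    · by_cases h : d' = d
      · subst h; simp; omega
      · simp [h, Ne.symm h]
    · simp

/-- Stated for an input in transit: `l` is still to be read, `r` has been moved, and every clock
holds `m` symbols. -/
theorem reachesIn_init [Fintype W] (p : LoopProgram W σ Γ D) {i t : W} (hit : i ≠ t) (v₀ : σ)
    (ans : σ → Bool) : ∀ (l r : List Γ) (m : ℕ),
      ReachesIn (machineCode p i t v₀ ans)
        ⟨some (.inl false), (none, v₀), contents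
          (Function.update (Function.update (fun _ => []) i l) t r) fun i => if i.2 then 0 else m⟩
        (l.length + 1)
        ⟨some (.inr p.entry), (none, v₀), contents
          (Function.update (fun _ => []) t (l.reverse ++ r))
          fun i => if i.2 then 0 else m + l.length⟩ := by
  intro l
  induction l with
  | nil =>
    intro r m
    refine ReachesIn.head (T := 0) ?_ ReachesIn.refl
    simp only [machineCode, TM2.stepAux]
    rw [update_contents_work]
    have : Function.update (Function.update (fun _ => []) t r) i [] =
        Function.update (fun _ => ([] : List Γ)) t r := by
      rw [Function.update_eq_self_iff, Function.update_of_ne hit]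
    simp [contents, Function.update_of_ne hit, this]
  | cons a l ih =>
    intro r m
    have h := ih (a :: r) (m + 1)
    have h1 : (a :: l).reverse ++ r = l.reverse ++ a :: r := by simp
    have h2 : m + (a :: l).length = m + 1 + l.length := by simp; omega
    rw [h1, h2]
    refine (ReachesIn.head ?_ h).mono le_rfl
    simp only [machineCode, TM2.stepAux]
    have h3 : (contents (Function.update (Function.update (fun _ => []) i (a :: l)) t r)
        (fun i : Fin D × Bool => if i.2 then 0 else m) (some (.inl i))) = a :: l := by
      simp [contents, Function.update_of_ne hit]
    rw [h3, update_contents_work]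
    simp only [List.head?_cons, Option.isSome_some, cond_true, Option.getD_some, List.tail_cons]
    rw [update_contents_work, stepAux_pushClocks]
    simp only [TM2.stepAux]
    congr 2
    · rw [Function.update_comm hit, Function.update_idem, Function.update_comm hit.symm]
      simp [contents, Function.update_of_ne hit.symm]
    · funext ⟨d, b⟩
      cases b <;> simp [List.count_eq_one_of_mem (List.nodup_finRange D) (List.mem_finRange d)]

/-- A halting configuration must have all stacks but the output empty and the initial internal
state. One step lowers every stack, so the greatest height bounds the time. -/
theorem reachesIn_clear [Fintype W] (p : LoopProgram W σ Γ D) (i t : W) (v₀ : σ)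
    (ans : σ → Bool) : ∀ (m : ℕ) (w : Option Γ) (v : σ)
      (S : ∀ k : Stack W D, List (StackSymbol W Γ D k)), S none = [] →
      (∀ k, (S (some k)).length ≤ m) →
      ReachesIn (machineCode p i t v₀ ans) ⟨some (.inl true), (w, v), S⟩ (m + 1)
        ⟨none, (none, v₀), Function.update (fun _ => []) none [ans v]⟩ := by
  intro m
  induction m with
  | zero =>
    intro w v S h0 hS
    refine ReachesIn.head (T := 0) ?_ ReachesIn.refl
    simp only [machineCode, TM2.stepAux]
    obtain ⟨a, S', h1, h2, h3, h4⟩ := stepAux_popAll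
      (.branch (fun v => v.1.isSome) (.goto fun _ => .inl true)
        (.push none (fun v => ans v.2) (.load (fun _ => (none, v₀)) .halt)) :
        MachineStmt W σ Γ D (Bool ⊕ p.Label)) Finset.univ.toList (Finset.nodup_toList _) (none, v) S
    have hS : ∀ k, S (some k) = [] := fun k => List.length_eq_zero_iff.1 (by have := hS k; omega)
    have ha : a = none := h2.2 ⟨rfl, fun k _ => hS k⟩
    rw [h1, ha]
    simp only [TM2.stepAux, Option.isSome_none, cond_false, h3, h0]
    congr 1
    funext k
    match k with
    | none => simp
    | some k => simp [(h4 k).1, hS]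
  | succ m ih =>
    intro w v S h0 hS
    obtain ⟨a, S', h1, h2, h3, h4⟩ := stepAux_popAll
      (.branch (fun v => v.1.isSome) (.goto fun _ => .inl true)
        (.push none (fun v => ans v.2) (.load (fun _ => (none, v₀)) .halt)) :
        MachineStmt W σ Γ D (Bool ⊕ p.Label)) Finset.univ.toList (Finset.nodup_toList _) (none, v) S
    match a with
    | none =>
      refine (ReachesIn.head (T := 0) ?_ ReachesIn.refl).mono (by omega)
      simp only [machineCode, TM2.stepAux]
      have hS : ∀ k, S (some k) = [] := fun k => (h2.1 rfl).2 k (by simp)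
      rw [h1]
      simp only [TM2.stepAux, Option.isSome_none, cond_false, h3, h0]
      congr 1
      funext k
      match k with
      | none => simp
      | some k => simp [(h4 k).1, hS]
    | some a =>
      refine ReachesIn.head ?_ (ih (some a) v S' (h3.trans h0) fun k => ?_)
      · simp only [machineCode, TM2.stepAux]
        rw [h1]
        simp
      · have := hS k
        simp [(h4 k).1]
        omega

theorem initList_eq_update (tm : FinTM2) (l : List (tm.Γ tm.k₀)) :
    initList tm l = ⟨some tm.main, tm.initialState, Function.update (fun _ => []) tm.k₀ l⟩ := by
  simp only [initList]
  congr 1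
  funext k
  by_cases h : k = tm.k₀
  · subst h; simp
  · rw [dif_neg h, Function.update_of_ne h]

theorem haltList_eq_update (tm : FinTM2) (l : List (tm.Γ tm.k₁)) :
    haltList tm l = ⟨none, tm.initialState, Function.update (fun _ => []) tm.k₁ l⟩ := by
  simp only [haltList]
  congr 1
  funext k
  by_cases h : k = tm.k₁
  · subst h; simp
  · rw [dif_neg h, Function.update_of_ne h]

/-- A set is decidable in polynomial time if a loop program, started with the reversed encoding of
an instance on the stack `t`, leaves the answer in the register. -/
theorem decidableInPolyTime [Fintype W] [Fintype Γ] [Fintype σ] (p : LoopProgram W σ Γ D)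
    (hp : p.Below D) {i t : W} (hit : i ≠ t) (v₀ : σ) (ans : σ → Bool) {X : Type}
    (encode : X → List Γ) (S : Set X)
    (h : ∀ x, ans (p.eval (encode x).length
      (v₀, Function.update (fun _ => []) t (encode x).reverse)).1 = true ↔ x ∈ S) :
    DecidableInPolyTime encode S := by
  refine ⟨fun x => ans (p.eval (encode x).length
      (v₀, Function.update (fun _ => []) t (encode x).reverse)).1, h, ⟨?_⟩⟩
  refine
    { tm := machine p i t v₀ ans
      inputAlphabet := Equiv.refl Γ
      outputAlphabet := Equiv.refl Bool
      -- Reversing the input takes `n + 1` steps, the program `cost`, and clearing stacks of height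
      -- at most `n + cost` takes `n + cost + 1`.
      time := 2 * Polynomial.X + 2 * p.cost + 2
      outputsFun := fun x => ?_ }
  set l := encode x with hl
  set s₀ : σ × (W → List Γ) := (v₀, Function.update (fun _ => []) t l.reverse) with hs₀
  have h1 := reachesIn_init p hit v₀ ans l [] 0
  rw [List.append_nil] at h1
  have h2 := reachesIn_code (machineCode p i t v₀ ans) l.length p D hp .inr (.inl true)
    (fun l => rfl) s₀ (fun i => if i.2 then 0 else 0 + l.length) (by simp)
  have h3 := reachesIn_clear p i t v₀ ans (l.length + p.cost.eval l.length) none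
    (p.eval l.length s₀).1
    (contents (p.eval l.length s₀).2 (fun i => if i.2 then 0 else 0 + l.length)) rfl (by
      rintro (k | ⟨d, b⟩)
      · refine (length_eval_le l.length p k s₀).trans ?_
        by_cases hk : k = t
        · subst hk; simp [hs₀]
        · simp [hs₀, Function.update_of_ne hk]
      · cases b <;> simp [contents])
  have h4 := ((h1.trans h2).trans h3).mono
    (show _ ≤ (2 * Polynomial.X + 2 * p.cost + 2 : Polynomial ℕ).eval l.length by
      simp; omega)
  have h5 : ReachesIn (machineCode p i t v₀ ans) (initList (machine p i t v₀ ans) l)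
      ((2 * Polynomial.X + 2 * p.cost + 2 : Polynomial ℕ).eval l.length)
      (haltList (machine p i t v₀ ans) [ans (p.eval l.length s₀).1]) := by
    have hinit : initList (machine p i t v₀ ans) l = ⟨some (.inl false), (none, v₀), contents
        (Function.update (Function.update (fun _ => []) i l) t [])
        fun i => if i.2 then 0 else 0⟩ := by
      have h0 : contents (W := W) (Γ := Γ) (D := D) (fun _ => []) (fun i => if i.2 then 0 else 0) =
          fun _ => [] := by
        funext k
        match k with
        | none => rfl
        | some (.inl k) => rfl
        | some (.inr (d, b)) => cases b <;> rfl
      have h0' : Function.update (Function.update (fun _ => ([] : List Γ)) i l) t [] =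
          Function.update (fun _ => []) i l := by
        rw [Function.update_eq_self_iff, Function.update_of_ne hit.symm]
      rw [h0', ← update_contents_work, h0]
      exact initList_eq_update (machine p i t v₀ ans) l
    rw [hinit, haltList_eq_update]
    exact h4
  have h6 : l.map (Equiv.refl Γ).invFun = l := by
    simp
  have h7 : (Computability.encodeBool (ans (p.eval l.length s₀).1)).map (Equiv.refl Bool).invFun =
      [ans (p.eval l.length s₀).1] := rfl
  refine (congrArg₂ (fun a b => TM2OutputsInTime (machine p i t v₀ ans) a (some b) _) h6 h7).mpr ?_
  -- The time certificate is data, whereas `ReachesIn` is an existential proposition.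
  refine Classical.choice ?_
  obtain ⟨T, hT, hT'⟩ := h5
  exact ⟨⟨⟨T, hT'⟩, hT⟩⟩

end LoopProgram

/-! ### A loop program for the decision problem -/

namespace UnaryPiecewise

open LoopProgram

/-- The stacks of the program: the rows of the input automaton (`rows`, and `rows'` for the rows
that have been read), the bits of the number (`key`), the vector of the initial states (`initial`),
the vector of the state to be checked next (`point`), the current set of states (`cur`), an
accumulator (`sum`), a copy of the current set (`copy`) and a scratch stack (`scratch`). -/
inductive Tape
  | rows | scratch | key | initial | rows' | point | cur | sum | copy
  deriving DecidableEq

instance : Fintype Tape where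
  elems := {.rows, .scratch, .key, .initial, .rows', .point, .cur, .sum, .copy}
  complete k := by cases k <;> simp

/-- The register of the program. -/
structure Register where
  /-- The symbol read last. -/
  sym : Option (Option Bool)
  /-- Whether the state of the current row belongs to the current set. -/
  active : Bool
  /-- The bit read last from the accumulator. -/
  bit : Bool
  /-- Whether the set before the last transition contains an accepting state. -/
  acc : Bool
  /-- Whether all tests have been passed. -/
  ok : Bool
  /-- Whether the current set is known to be nonempty. -/
  seen : Bool
  /-- The value of `acc` to compare with. -/
  ref : Bool
  /-- The borrow of a decrement. -/
  borrow : Bool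
  /-- Whether the bits of the number are being read. -/
  inKey : Bool
  /-- Whether a row begins. -/
  rowStart : Bool

noncomputable instance : Fintype Register :=
  Fintype.ofInjective
    (fun v : Register => (v.sym, v.active, v.bit, v.acc, v.ok, v.seen, v.ref, v.borrow, v.inKey,
      v.rowStart))
    (by rintro ⟨⟩ ⟨⟩ h; simpa using h)

/-- The type of the programs considered. -/
abbrev Program : Type := LoopProgram Tape Register (Option Bool) 4

/-- The states of such programs. -/
abbrev State : Type := Register × (Tape → List (Option Bool))

/-- The tape contents with the given stacks. -/
def tapes (r t k i r' p x a c : List (Option Bool)) : Tape → List (Option Bool)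
  | .rows => r
  | .scratch => t
  | .key => k
  | .initial => i
  | .rows' => r'
  | .point => p
  | .cur => x
  | .sum => a
  | .copy => c

section tapes

variable (r t k i r' p x a c l : List (Option Bool))

@[simp] theorem tapes_rows : tapes r t k i r' p x a c .rows = r := (rfl)
@[simp] theorem tapes_scratch : tapes r t k i r' p x a c .scratch = t := (rfl)
@[simp] theorem tapes_key : tapes r t k i r' p x a c .key = k := (rfl)
@[simp] theorem tapes_initial : tapes r t k i r' p x a c .initial = i := (rfl)
@[simp] theorem tapes_rows' : tapes r t k i r' p x a c .rows' = r' := (rfl)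
@[simp] theorem tapes_point : tapes r t k i r' p x a c .point = p := (rfl)
@[simp] theorem tapes_cur : tapes r t k i r' p x a c .cur = x := (rfl)
@[simp] theorem tapes_sum : tapes r t k i r' p x a c .sum = a := (rfl)
@[simp] theorem tapes_copy : tapes r t k i r' p x a c .copy = c := (rfl)

@[simp] theorem update_rows :
    Function.update (tapes r t k i r' p x a c) .rows l = tapes l t k i r' p x a c := by
  funext j; cases j <;> rfl
@[simp] theorem update_scratch :
    Function.update (tapes r t k i r' p x a c) .scratch l = tapes r l k i r' p x a c := by
  funext j; cases j <;> rfl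
@[simp] theorem update_key :
    Function.update (tapes r t k i r' p x a c) .key l = tapes r t l i r' p x a c := by
  funext j; cases j <;> rfl
@[simp] theorem update_initial :
    Function.update (tapes r t k i r' p x a c) .initial l = tapes r t k l r' p x a c := by
  funext j; cases j <;> rfl
@[simp] theorem update_rows' :
    Function.update (tapes r t k i r' p x a c) .rows' l = tapes r t k i l p x a c := by
  funext j; cases j <;> rfl
@[simp] theorem update_point :
    Function.update (tapes r t k i r' p x a c) .point l = tapes r t k i r' l x a c := by
  funext j; cases j <;> rfl
@[simp] theorem update_cur :
    Function.update (tapes r t k i r' p x a c) .cur l = tapes r t k i r' p l a c := by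
  funext j; cases j <;> rfl
@[simp] theorem update_sum :
    Function.update (tapes r t k i r' p x a c) .sum l = tapes r t k i r' p x l c := by
  funext j; cases j <;> rfl
@[simp] theorem update_copy :
    Function.update (tapes r t k i r' p x a c) .copy l = tapes r t k i r' p x a l := by
  funext j; cases j <;> rfl

end tapes

/-! ### Subroutines and the decision program -/

/-- Do nothing. -/
def skip : Program := load id

/-- Reset the symbol read last. -/
def reset : Program := load fun v => { v with sym := none }

/-- Execute the programs of a list one after another. -/
def block : List Program → Program
  | [] => skip
  | [p] => p
  | p :: q :: l => seq p (block (q :: l))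

/-- Push the symbol read last on a stack. -/
def pushSym (k : Tape) : Program := push k fun v => v.sym.getD none

/-- Empty the stack `k`, and execute the program `p` for every symbol popped. -/
def forEach (d : Fin 4) (k : Tape) (p : Program) : Program :=
  seq reset (loop d (block
    [pop k fun v a => { v with sym := a }, ite (fun v => v.sym.isSome) p skip, reset]))

/-- Move the stack `k` to `l`, reversing it. -/
def move (k l : Tape) : Program := forEach 0 k (pushSym l)

/-- Move the stack `k` to both `l` and `m`, reversing it. -/
def move₂ (k l m : Tape) : Program := forEach 0 k (block [pushSym l, pushSym m])

/-- Is the symbol the bit `true`? -/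
def isTrue (a : Option (Option Bool)) : Bool := a == some (some true)

/-- Process a symbol of a row: add it to the accumulator if the state of the row belongs to the
current set. -/
def passSymbol : Program :=
  ite (fun v => v.sym == some none)
    (block [pushSym .rows', move .scratch .sum, pop .cur fun v a => { v with active := isTrue a }])
    (block [pop .sum fun v a => { v with bit := isTrue a },
      push .scratch fun v => some (v.bit || (v.active && isTrue v.sym)), pushSym .rows',
      load fun v => { v with bit := false }])

/-- Replace the current set of states by the set of its successors, and find out whether it contains
an accepting state. -/
def pass : Program := block
  [pop .cur fun v a => { v with active := isTrue a, bit := false },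
   forEach 1 .rows passSymbol,
   move .rows' .rows,
   pop .sum fun v _ => v,
   pop .sum fun v a => { v with acc := isTrue a, active := false },
   move .sum .scratch,
   move .scratch .cur]

/-- Process a symbol of the input. -/
def parseSymbol : Program :=
  ite (fun v => v.inKey)
    (ite (fun v => v.sym == some none)
      (load fun v => { v with inKey := false, rowStart := true }) (pushSym .scratch))
    (ite (fun v => v.rowStart)
      (block [pushSym .initial, push .point fun _ => some false, pushSym .rows',
        load fun v => { v with rowStart := false }])
      (block [pushSym .rows', load fun v => { v with rowStart := v.sym == some none }]))

/-- Split the input into its parts. -/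
def parse : Program := block
  [move .scratch .rows,
   push .point fun _ => some true,
   load fun v => { v with inKey := true, rowStart := false },
   forEach 0 .rows parseSymbol,
   move .scratch .key,
   move .rows' .rows]

/-- Compare a symbol of the current set with that of its copy. -/
def checkSymbol : Program := pop .copy fun v a =>
  { v with
    ok := v.ok && (v.sym == a) && !(v.seen && isTrue v.sym)
    seen := v.seen || isTrue v.sym }

/-- Test whether the long paths from a fixed state all lead to the same state. -/
def check : Program := block
  [move .point .scratch,
   move₂ .scratch .point .cur,
   loop 2 pass,
   move .cur .scratch,
   move₂ .scratch .cur .copy,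
   pass,
   load fun v => { v with seen := false },
   forEach 0 .cur checkSymbol,
   load fun v => { v with ok := v.ok && v.seen, seen := false, acc := false }]

/-- Test the state given by the vector on the stack `point`. -/
def checkPoint : Program := ite (fun v => v.sym == some (some false)) check skip

/-- Test all states. -/
def checkAll : Program := forEach 3 .point checkPoint

/-- Process a bit of the number. -/
def decrementBit : Program := block
  [push .scratch fun v => some (isTrue v.sym ^^ v.borrow),
   load fun v => { v with borrow := v.borrow && !isTrue v.sym }]

/-- Decrement the number; the register `borrow` tells whether it was zero. -/
def decrement : Program := block
  [load fun v => { v with borrow := true },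
   forEach 0 .key decrementBit,
   move .scratch .key]

/-- Decrement the number and make one transition, unless the number is zero. -/
def advanceStep : Program :=
  ite (fun v => v.borrow) skip (block [decrement, ite (fun v => v.borrow) skip pass])

/-- Compute the set of the states reached from the initial states by a word whose length is the
number, or the length of the input if that is smaller. -/
def advance : Program := loop 2 advanceStep

/-- Make one transition and compare the acceptance of the current set. -/
def compareStep : Program := block
  [pass, load fun v => { v with ok := v.ok && (v.acc == v.ref) }]

/-- Test whether the acceptance of the following words remains the same. -/
def compareWords : Program := block
  [pass, load fun v => { v with ref := v.acc },
   loop 2 compareStep]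

/-- The decision procedure. -/
def decisionProgram : Program := block [parse, checkAll, move .initial .cur, advance, compareWords]

theorem decisionProgram_below : decisionProgram.Below 4 := by
  simp [decisionProgram, Below, block, parse, checkAll, move, move₂, advance, compareWords,
    pass, check, decrement,
    forEach, pushSym, skip, reset, passSymbol, parseSymbol,
    checkSymbol, checkPoint, decrementBit, advanceStep, compareStep]

/-! #### Loops over stacks -/

@[simp] theorem eval_push (n : ℕ) (k : Tape) (f : Register → Option Bool) (s : State) :
    eval n (push k f : Program) s = (s.1, Function.update s.2 k (f s.1 :: s.2 k)) := rfl

@[simp] theorem eval_pop (n : ℕ) (k : Tape) (f : Register → Option (Option Bool) → Register)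
    (s : State) : eval n (pop k f : Program) s =
      (f s.1 (s.2 k).head?, Function.update s.2 k (s.2 k).tail) := rfl

@[simp] theorem eval_load (n : ℕ) (f : Register → Register) (s : State) :
    eval n (load f : Program) s = (f s.1, s.2) := rfl

@[simp] theorem eval_ite (n : ℕ) (c : Register → Bool) (p q : Program) (s : State) :
    eval n (ite c p q) s = if c s.1 then p.eval n s else q.eval n s := rfl

theorem eval_loop (n : ℕ) (d : Fin 4) (p : Program) (s : State) :
    eval n (loop d p) s = (p.eval n)^[n] s := rfl

@[simp] theorem eval_block_nil (n : ℕ) (s : State) : (block []).eval n s = s := rfl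

@[simp] theorem eval_block_cons (n : ℕ) (p : Program) (l : List Program) (s : State) :
    (block (p :: l)).eval n s = (block l).eval n (p.eval n s) := by
  cases l <;> rfl

@[simp] theorem eval_reset (n : ℕ) (s : State) :
    reset.eval n s = ({ s.1 with sym := none }, s.2) := rfl

@[simp] theorem eval_skip (n : ℕ) (s : State) : skip.eval n s = s := rfl

@[simp] theorem eval_pushSym (n : ℕ) (k : Tape) (s : State) :
    (pushSym k).eval n s = (s.1, Function.update s.2 k (s.1.sym.getD none :: s.2 k)) := rfl

/-- Reduces a loop over a stack to a fold on abstract data `β`, which `reg` and `tape` translate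
into registers and stacks. `Inv` carries the size bounds that loops inside the body need. -/
theorem eval_forEach {n : ℕ} (d : Fin 4) (k : Tape) (p : Program) {β : Type}
    (reg : β → Register) (tape : β → List (Option Bool) → Tape → List (Option Bool))
    (F : β → List (Option Bool) → β) (g : β → Option Bool → List (Option Bool) → β)
    (hnil : ∀ b, F b [] = b) (hcons : ∀ b a l, F b (a :: l) = F (g b a l) l)
    (hreg : ∀ b, (reg b).sym = none)
    (htape : ∀ b l, tape b l k = l)
    (hupdate : ∀ b l l', Function.update (tape b l) k l' = tape b l')
    (Inv : β → List (Option Bool) → Prop) (hInv : ∀ b a l, Inv b (a :: l) → Inv (g b a l) l)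
    (hp : ∀ b a l, Inv b (a :: l) →
      reset.eval n (p.eval n ({ reg b with sym := some a }, tape b l)) =
        (reg (g b a l), tape (g b a l) l))
    (v : Register) (b : β) (l : List (Option Bool)) (hv : { v with sym := none } = reg b)
    (hl : l.length ≤ n) (hb : Inv b l) :
    (forEach d k p).eval n (v, tape b l) = (reg (F b l), tape (F b l) []) := by
  have hreset : ∀ b, ({ reg b with sym := none } : Register) = reg b := fun b => by rw [← hreg b]
  set B : Program := block
    [pop k fun v a => { v with sym := a }, ite (fun v => v.sym.isSome) p skip, reset] with hB
  -- Popping an empty stack yields `none`, so surplus iterations are idle.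
  have h0 : ∀ b, B.eval n (reg b, tape b []) = (reg b, tape b []) := by
    intro b
    simp [hB, htape, hupdate, hreset, hreg]
  have h1 : ∀ b a l, Inv b (a :: l) →
      B.eval n (reg b, tape b (a :: l)) = (reg (g b a l), tape (g b a l) l) := by
    intro b a l hal
    rw [← hp b a l hal]
    simp [hB, htape, hupdate]
  have h2 : ∀ m l b, l.length ≤ m → Inv b l →
      (B.eval n)^[m] (reg b, tape b l) = (reg (F b l), tape (F b l) []) := by
    intro m
    induction m with
    | zero =>
      intro l b hl _
      obtain rfl : l = [] := List.length_eq_zero_iff.1 (by omega)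
      rw [hnil]
      rfl
    | succ m ih =>
      intro l b hl hb
      rw [Function.iterate_succ_apply]
      match l with
      | [] => rw [h0, ih [] b (by simp) hb]
      | a :: l =>
        rw [h1 b a l hb, ih l _ (by simpa using hl) (hInv b a l hb), hcons]
  change (B.eval n)^[n] ({ v with sym := none }, tape b l) = _
  rw [hv]
  exact h2 n l b hl hb

theorem eval_move {n : ℕ} {k k' : Tape} (h : k ≠ k') (s : State) (hl : (s.2 k).length ≤ n) :
    (move k k').eval n s = ({ s.1 with sym := none },
      Function.update (Function.update s.2 k []) k' ((s.2 k).reverse ++ s.2 k')) := by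
  have := eval_forEach (n := n) 0 k (pushSym k') (β := List (Option Bool))
    (fun _ => { s.1 with sym := none })
    (fun b l => Function.update (Function.update s.2 k l) k' b)
    (fun b l => l.reverse ++ b) (fun b a _ => a :: b) (by simp) (by simp) (by simp)
    (fun b l => by simp [Function.update_of_ne h])
    (fun b l l' => by rw [Function.update_comm h.symm, Function.update_idem])
    (fun _ _ => True) (fun _ _ _ _ => trivial) (fun b a l _ => by simp)
    s.1 (s.2 k') (s.2 k) rfl hl trivial
  simp only [Function.update_eq_self] at this
  exact this

theorem eval_move₂ {n : ℕ} {k k' k'' : Tape} (h : k ≠ k') (h' : k ≠ k'') (h'' : k' ≠ k'')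
    (s : State) (hl : (s.2 k).length ≤ n) :
    (move₂ k k' k'').eval n s = ({ s.1 with sym := none },
      Function.update (Function.update (Function.update s.2 k []) k' ((s.2 k).reverse ++ s.2 k'))
        k'' ((s.2 k).reverse ++ s.2 k'')) := by
  have := eval_forEach (n := n) 0 k (block [pushSym k', pushSym k'']) (β := List (Option Bool))
    (fun _ => { s.1 with sym := none })
    (fun b l => Function.update (Function.update (Function.update s.2 k l) k' (b ++ s.2 k'))
      k'' (b ++ s.2 k''))
    (fun b l => l.reverse ++ b) (fun b a _ => a :: b) (by simp) (by simp) (by simp)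
    (fun b l => by simp [Function.update_of_ne h, Function.update_of_ne h'])
    (fun b l l' => by
      rw [Function.update_comm h'.symm, Function.update_comm h.symm, Function.update_idem])
    (fun _ _ => True) (fun _ _ _ _ => trivial) (fun b a l _ => by
      simp [Function.update_of_ne h'',
        Function.update_comm h''.symm])
    s.1 [] (s.2 k) rfl hl trivial
  simp only [Function.update_eq_self, List.nil_append, List.append_nil] at this
  exact this

/-! #### One transition -/

/-- The encoding of the rows of an automaton. -/
def encodeRows (rows : List (List Bool)) : List (Option Bool) :=
  rows.flatMap fun l => l.map some ++ [none]

/-- Add the row `l` to the accumulator `A` if `x` holds. -/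
def addRow (x : Bool) : List Bool → List (Option Bool) → List (Option Bool)
  | [], A => A
  | r :: l, A => some (isTrue A.head? || (x && r)) :: addRow x l A.tail

/-- Add the rows of the states in the set `X` to the accumulator `A`. -/
def addRows : List (Option Bool) → List (Option Bool) → List (List Bool) → List (Option Bool)
  | _, A, [] => A
  | X, A, l :: rows => addRows X.tail (addRow (isTrue X.head?) l A) rows

/-- The data which are changed when the rows are read. -/
structure PassData where
  /-- Whether the state of the current row belongs to the current set. -/
  active : Bool
  /-- The remainder of the current set. -/
  cur : List (Option Bool)
  /-- The part of the accumulator to which the current row has not been added. -/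
  sum : List (Option Bool)
  /-- The part of the accumulator to which the current row has been added, reversed. -/
  scratch : List (Option Bool)
  /-- The symbols that have been read, reversed. -/
  rows' : List (Option Bool)

/-- The effect of one symbol. -/
def PassData.next (b : PassData) : Option Bool → PassData
  | none => ⟨isTrue b.cur.head?, b.cur.tail, b.scratch.reverse ++ b.sum, [], none :: b.rows'⟩
  | some r => ⟨b.active, b.cur, b.sum.tail,
      some (isTrue b.sum.head? || (b.active && r)) :: b.scratch, some r :: b.rows'⟩

theorem PassData.foldl_next_row (l : List Bool) (b : PassData) :
    (l.map some ++ [none]).foldl PassData.next b = ⟨isTrue b.cur.head?, b.cur.tail,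
      b.scratch.reverse ++ addRow b.active l b.sum, [],
      (l.map some ++ [none]).reverse ++ b.rows'⟩ := by
  induction l generalizing b with
  | nil => rfl
  | cons r l ih =>
    simp only [List.map_cons, List.cons_append, List.foldl_cons]
    rw [ih]
    simp [PassData.next, addRow]

theorem PassData.foldl_next_rows (rows : List (List Bool)) (X A Q : List (Option Bool)) :
    (encodeRows rows).foldl PassData.next ⟨isTrue X.head?, X.tail, A, [], Q⟩ =
      ⟨isTrue (X.drop rows.length).head?, (X.drop rows.length).tail, addRows X A rows, [],
        (encodeRows rows).reverse ++ Q⟩ := by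
  induction rows generalizing X A Q with
  | nil => simp [encodeRows, addRows]
  | cons l rows ih =>
    have : encodeRows (l :: rows) = (l.map some ++ [none]) ++ encodeRows rows := rfl
    rw [this, List.foldl_append, PassData.foldl_next_row]
    simp only [List.reverse_nil, List.nil_append]
    rw [ih]
    simp [addRows]

theorem length_addRow (x : Bool) (l : List Bool) (A : List (Option Bool)) :
    (addRow x l A).length = max l.length A.length := by
  induction l generalizing A with
  | nil => simp [addRow]
  | cons r l ih =>
    simp [addRow, ih]
    omega

theorem length_addRows_le (rows : List (List Bool)) (X A : List (Option Bool)) (w : ℕ)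
    (hA : A.length ≤ w) (hw : ∀ l ∈ rows, l.length ≤ w) : (addRows X A rows).length ≤ w := by
  induction rows generalizing X A with
  | nil => exact hA
  | cons l rows ih =>
    refine ih _ _ ?_ fun l' hl' => hw l' (List.mem_cons_of_mem _ hl')
    rw [length_addRow]
    exact max_le (hw l List.mem_cons_self) hA

theorem le_length_addRows (rows : List (List Bool)) (X A : List (Option Bool)) :
    A.length ≤ (addRows X A rows).length := by
  induction rows generalizing X A with
  | nil => exact le_rfl
  | cons l rows ih =>
    refine le_trans ?_ (ih _ _)
    rw [length_addRow]
    exact le_max_right _ _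

theorem length_addRows {rows : List (List Bool)} (X : List (Option Bool)) {w : ℕ} (h0 : rows ≠ [])
    (hw : ∀ l ∈ rows, l.length = w) : (addRows X [] rows).length = w := by
  refine le_antisymm (length_addRows_le _ _ _ _ (Nat.zero_le _) fun l hl => (hw l hl).le) ?_
  cases rows with
  | nil => exact absurd rfl h0
  | cons l rows =>
    refine le_trans ?_ (le_length_addRows rows X.tail (addRow (isTrue X.head?) l []))
    rw [length_addRow, hw l List.mem_cons_self]
    exact le_max_left _ _

theorem length_le_length_encodeRows {rows : List (List Bool)} {l : List Bool} (hl : l ∈ rows) :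
    l.length ≤ (encodeRows rows).length := by
  induction rows with
  | nil => simp at hl
  | cons l' rows ih =>
    have : encodeRows (l' :: rows) = (l'.map some ++ [none]) ++ encodeRows rows := rfl
    rw [this]
    rcases List.mem_cons.1 hl with rfl | hl
    · simp
    · have := ih hl
      simp; omega

theorem isTrue_addRow (x : Bool) (l : List Bool) (A : List (Option Bool)) (i : ℕ) :
    isTrue (addRow x l A)[i]? = (isTrue A[i]? || (x && l[i]? == some true)) := by
  induction l generalizing A i with
  | nil => simp [addRow]
  | cons r l ih =>
    cases i with
    | zero => simp [addRow, isTrue, List.head?_eq_getElem?]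
    | succ i => simp [addRow, ih]

/-- This is the Boolean product of the vector `X` with the matrix of rows, added to `A`. Missing
entries count as `false`. -/
theorem isTrue_addRows (rows : List (List Bool)) (X A : List (Option Bool)) (i : ℕ) :
    isTrue (addRows X A rows)[i]? = true ↔ isTrue A[i]? = true ∨
      ∃ (p : ℕ) (l : List Bool), rows[p]? = some l ∧ isTrue X[p]? = true ∧ l[i]? = some true := by
  induction rows generalizing X A with
  | nil => simp [addRows]
  | cons l rows ih =>
    rw [addRows, ih, isTrue_addRow]
    constructor
    · rintro (h | ⟨p, l', h1, h2, h3⟩)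
      · rw [Bool.or_eq_true, Bool.and_eq_true] at h
        rcases h with h | ⟨h2, h3⟩
        · exact Or.inl h
        · exact Or.inr ⟨0, l, rfl, (by rwa [← List.head?_eq_getElem?]), by simpa using h3⟩
      · exact Or.inr ⟨p + 1, l', by simpa using h1, by simpa using h2, h3⟩
    · rintro (h | ⟨p, l', h1, h2, h3⟩)
      · exact Or.inl (by simp [h])
      · cases p with
        | zero =>
          obtain rfl : l = l' := by simpa using h1
          refine Or.inl ?_
          rw [List.head?_eq_getElem?, h2, h3]
          simp
        | succ p => exact Or.inr ⟨p, l', by simpa using h1, by simpa using h2, h3⟩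

theorem ne_none_of_mem_addRow (x : Bool) (l : List Bool) (A : List (Option Bool))
    (hA : ∀ a ∈ A, a ≠ none) : ∀ a ∈ addRow x l A, a ≠ none := by
  induction l generalizing A with
  | nil => exact hA
  | cons r l ih =>
    intro a ha
    rcases List.mem_cons.1 ha with rfl | ha
    · simp
    · exact ih A.tail (fun b hb => hA b (List.mem_of_mem_tail hb)) a ha

theorem ne_none_of_mem_addRows (rows : List (List Bool)) (X A : List (Option Bool))
    (hA : ∀ a ∈ A, a ≠ none) : ∀ a ∈ addRows X A rows, a ≠ none := by
  induction rows generalizing X A with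
  | nil => exact hA
  | cons l rows ih => exact ih _ _ (ne_none_of_mem_addRow _ _ _ hA)

/-- The set of the successors of the states in `X`. -/
def nextSet (rows : List (List Bool)) (X : List (Option Bool)) : List (Option Bool) :=
  (addRows X [] rows).tail.tail

/-- Whether the set `X` contains an accepting state. -/
def accepting (rows : List (List Bool)) (X : List (Option Bool)) : Bool :=
  isTrue (addRows X [] rows).tail.head?

/-- The first two columns hold the initial and accepting flags, so one sweep yields the acceptance
of `X` in the second entry and its successor set after it. As `X` is no longer than the list of
rows, the sweep empties `cur`. -/
theorem eval_pass {n : ℕ} (rows : List (List Bool)) (hn : (encodeRows rows).length ≤ n)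
    (v : Register) (K I P X C : List (Option Bool)) (hX : X.length ≤ rows.length) :
    pass.eval n (v, tapes (encodeRows rows) [] K I [] P X [] C) =
      ({ v with sym := none, active := false, bit := false, acc := accepting rows X },
        tapes (encodeRows rows) [] K I [] P (nextSet rows X) [] C) := by
  have hw : (addRows X [] rows).length ≤ n :=
    (length_addRows_le rows X [] _ (Nat.zero_le _)
      fun l hl => length_le_length_encodeRows hl).trans hn
  have hloop : (forEach 1 .rows passSymbol).eval n
      ({ v with active := isTrue X.head?, bit := false },
        tapes (encodeRows rows) [] K I [] P X.tail [] C) =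
      ({ v with sym := none, active := false, bit := false },
        tapes [] [] K I (encodeRows rows).reverse P [] (addRows X [] rows) C) := by
    have h := eval_forEach (n := n) 1 .rows passSymbol
      (fun b : PassData => { v with sym := none, active := b.active, bit := false })
      (fun b l => tapes l b.scratch K I b.rows' P b.cur b.sum C)
      (fun b l => l.foldl PassData.next b) (fun b a _ => b.next a)
      (fun _ => rfl) (fun _ _ _ => rfl) (fun _ => rfl) (fun _ _ => rfl) (by simp)
      -- The `move` at the end of each row requires `scratch` to have at most `n` symbols.
      (fun b l => b.scratch.length + l.length ≤ n)
      (by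
        rintro b (_ | r) l h
        · simp [PassData.next] at h ⊢
          omega
        · simp [PassData.next] at h ⊢
          omega)
      (by
        rintro b (_ | r) l h
        · have h' : b.scratch.length ≤ n := by omega
          simp [passSymbol, eval_move, h', PassData.next]
        · simp [passSymbol, PassData.next, isTrue])
      { v with active := isTrue X.head?, bit := false }
      ⟨isTrue X.head?, X.tail, [], [], []⟩ (encodeRows rows) rfl hn (by simpa using hn)
    rw [PassData.foldl_next_rows, List.drop_eq_nil_of_le hX] at h
    simpa [isTrue] using h
  have hA : (addRows X [] rows).length - 1 - 1 ≤ n := by omega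
  simp [pass, hloop, eval_move, hA, hn, nextSet, accepting]

/-! #### Parsing the input -/

/-- The data which are changed when the input is read. -/
structure ParseData where
  /-- Whether the bits of the number are being read. -/
  inKey : Bool
  /-- Whether a row begins. -/
  rowStart : Bool
  /-- The bits of the number that have been read, reversed. -/
  scratch : List (Option Bool)
  /-- The vector of the initial states, reversed. -/
  initial : List (Option Bool)
  /-- A symbol `false` for every row that has been read, above a symbol `true`. -/
  point : List (Option Bool)
  /-- The symbols of the rows that have been read, reversed. -/
  rows' : List (Option Bool)

/-- The effect of one symbol. -/
def ParseData.next (b : ParseData) (a : Option Bool) : ParseData :=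
  if b.inKey then
    if a == none then ⟨false, true, b.scratch, b.initial, b.point, b.rows'⟩
    else ⟨true, b.rowStart, a :: b.scratch, b.initial, b.point, b.rows'⟩
  else if b.rowStart then
    ⟨false, false, b.scratch, a :: b.initial, some false :: b.point, a :: b.rows'⟩
  else ⟨false, a == none, b.scratch, b.initial, b.point, a :: b.rows'⟩

theorem ParseData.foldl_next_key (l : List Bool) (t i p r : List (Option Bool)) :
    (l.map some).foldl ParseData.next ⟨true, false, t, i, p, r⟩ =
      ⟨true, false, (l.map some).reverse ++ t, i, p, r⟩ := by
  induction l generalizing t with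
  | nil => rfl
  | cons a l ih => simp [ParseData.next, ih]

theorem ParseData.foldl_next_row (l : List Bool) (t i p r : List (Option Bool)) :
    (l.map some ++ [none]).foldl ParseData.next ⟨false, false, t, i, p, r⟩ =
      ⟨false, true, t, i, p, (l.map some ++ [none]).reverse ++ r⟩ := by
  induction l generalizing r with
  | nil => simp [ParseData.next]
  | cons a l ih =>
    simp only [List.map_cons, List.cons_append, List.foldl_cons]
    have : ParseData.next ⟨false, false, t, i, p, r⟩ (some a) =
      ⟨false, false, t, i, p, some a :: r⟩ := by simp [ParseData.next]
    rw [this, ih]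
    simp

/-- The first symbols of the rows. -/
def firstSymbols (rows : List (List Bool)) : List (Option Bool) :=
  rows.map fun l => some (l.headD false)

theorem ParseData.foldl_next_rows (rows : List (List Bool)) (hrows : ∀ l ∈ rows, l ≠ [])
    (t i p r : List (Option Bool)) :
    (encodeRows rows).foldl ParseData.next ⟨false, true, t, i, p, r⟩ =
      ⟨false, true, t, (firstSymbols rows).reverse ++ i,
        List.replicate rows.length (some false) ++ p, (encodeRows rows).reverse ++ r⟩ := by
  induction rows generalizing i p r with
  | nil => rfl
  | cons l rows ih =>
    have : encodeRows (l :: rows) = (l.map some ++ [none]) ++ encodeRows rows := rfl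
    rw [this, List.foldl_append]
    match l with
    | [] => exact absurd rfl (hrows [] List.mem_cons_self)
    | a :: l =>
      have : ParseData.next ⟨false, true, t, i, p, r⟩ (some a) =
        ⟨false, false, t, some a :: i, some false :: p, some a :: r⟩ := by simp [ParseData.next]
      rw [List.map_cons, List.cons_append, List.foldl_cons, this, ParseData.foldl_next_row,
        ih fun l hl => hrows l (List.mem_cons_of_mem _ hl)]
      simp [firstSymbols, List.replicate_succ']

/-- The initial vector is left reversed; the later move to `cur` restores its order. -/
theorem eval_parse {n : ℕ} (key : List Bool) (rows : List (List Bool)) (hrows : ∀ l ∈ rows, l ≠ [])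
    (hn : (key.map some ++ none :: encodeRows rows).length ≤ n) (v : Register) :
    parse.eval n
        (v, tapes [] (key.map some ++ none :: encodeRows rows).reverse [] [] [] [] [] [] []) =
      ({ v with sym := none, inKey := false, rowStart := true }, tapes (encodeRows rows) []
        (key.map some) (firstSymbols rows).reverse []
        (List.replicate rows.length (some false) ++ [some true]) [] [] []) := by
  have hloop : (forEach 0 .rows parseSymbol).eval n
      ({ v with sym := none, inKey := true, rowStart := false },
        tapes (key.map some ++ none :: encodeRows rows) [] [] [] [] [some true] [] [] []) =
      ({ v with sym := none, inKey := false, rowStart := true },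
        tapes [] (key.map some).reverse [] (firstSymbols rows).reverse (encodeRows rows).reverse
          (List.replicate rows.length (some false) ++ [some true]) [] [] []) := by
    have h := eval_forEach (n := n) 0 .rows parseSymbol
      (fun b : ParseData => { v with sym := none, inKey := b.inKey, rowStart := b.rowStart })
      (fun b l => tapes l b.scratch [] b.initial b.rows' b.point [] [] [])
      (fun b l => l.foldl ParseData.next b) (fun b a _ => b.next a)
      (fun _ => rfl) (fun _ _ _ => rfl) (fun _ => rfl) (fun _ _ => tapes_rows ..) (by simp)
      (fun _ _ => True) (fun _ _ _ _ => trivial)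
      (by
        rintro ⟨k, w, t, i, p, r⟩ a l -
        cases k <;> cases w <;> cases a <;> simp [parseSymbol, ParseData.next])
      { v with sym := none, inKey := true, rowStart := false }
      ⟨true, false, [], [], [some true], []⟩
      _ rfl hn trivial
    have hnext : ∀ t i p r, ParseData.next ⟨true, false, t, i, p, r⟩ none =
      ⟨false, true, t, i, p, r⟩ := fun _ _ _ _ => rfl
    rw [List.foldl_append, ParseData.foldl_next_key, List.foldl_cons, hnext,
      ParseData.foldl_next_rows rows hrows] at h
    simpa using h
  have h1 : (key.map some ++ none :: encodeRows rows).reverse.length ≤ n := by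
    rwa [List.length_reverse]
  have h2 : (encodeRows rows).reverse.length ≤ n := by simp at hn ⊢; omega
  have h3 : (key.map some).reverse.length ≤ n := by simp at hn ⊢; omega
  rw [parse, eval_block_cons, eval_move (by simp) _ (by simpa only [tapes_scratch] using h1)]
  simp only [tapes_scratch, tapes_rows, update_scratch, update_rows, List.reverse_reverse,
    List.append_nil]
  rw [eval_block_cons, eval_push, eval_block_cons, eval_load]
  simp only [tapes_point, update_point]
  rw [eval_block_cons, hloop, eval_block_cons,
    eval_move (by simp) _ (by simpa only [tapes_scratch] using h3)]
  simp only [tapes_scratch, tapes_key, update_scratch, update_key]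
  rw [eval_block_cons, eval_move (by simp) _ (by simpa only [tapes_rows'] using h2)]
  simp

/-! #### Testing the states -/

section

variable {rows : List (List Bool)} {n : ℕ}

theorem length_nextSet (h0 : rows ≠ []) (hw : ∀ l ∈ rows, l.length = rows.length + 2)
    (X : List (Option Bool)) : (nextSet rows X).length = rows.length := by
  simp [nextSet, length_addRows X h0 hw]

theorem length_iterate_nextSet_le (h0 : rows ≠ []) (hw : ∀ l ∈ rows, l.length = rows.length + 2)
    {X : List (Option Bool)} (hX : X.length ≤ rows.length) (m : ℕ) :
    ((nextSet rows)^[m] X).length ≤ rows.length := by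
  cases m with
  | zero => exact hX
  | succ m =>
    rw [Function.iterate_succ_apply', length_nextSet h0 hw]

theorem eval_iterate_pass (h0 : rows ≠ []) (hw : ∀ l ∈ rows, l.length = rows.length + 2)
    (hn : (encodeRows rows).length ≤ n) (v : Register)
    (hv : v = { v with sym := none, active := false, bit := false })
    (K I P X C : List (Option Bool)) (hX : X.length ≤ rows.length) (m : ℕ) :
    ∃ a, (pass.eval n)^[m] (v, tapes (encodeRows rows) [] K I [] P X [] C) =
      ({ v with acc := a }, tapes (encodeRows rows) [] K I [] P ((nextSet rows)^[m] X) [] C) := by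
  induction m with
  | zero => exact ⟨v.acc, rfl⟩
  | succ m ih =>
    obtain ⟨a, ih⟩ := ih
    rw [Function.iterate_succ_apply', ih,
      eval_pass rows hn _ _ _ _ _ _ (length_iterate_nextSet_le h0 hw hX m)]
    refine ⟨accepting rows ((nextSet rows)^[m] X), ?_⟩
    rw [Function.iterate_succ_apply', hv]

/-- The data which are changed when a set is compared with its copy: whether all tests have been
passed, whether a state has been seen, and the remainder of the copy. -/
structure CheckData where
  /-- Whether all tests have been passed. -/
  ok : Bool
  /-- Whether a state has been seen. -/
  seen : Bool
  /-- The remainder of the copy. -/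
  copy : List (Option Bool)

/-- The effect of one symbol. -/
def CheckData.next (b : CheckData) (a : Option Bool) : CheckData :=
  ⟨b.ok && (some a == b.copy.head?) && !(b.seen && isTrue (some a)), b.seen || isTrue (some a),
    b.copy.tail⟩

/-- One sweep tests equality with the copy and the presence of at most one state; the final `seen`
supplies at least one. -/
theorem CheckData.foldl_next (X : List (Option Bool)) (b : CheckData)
    (hX : X.length = b.copy.length) :
    ((X.foldl CheckData.next b).ok = true ↔
      b.ok = true ∧ X = b.copy ∧ X.count (some true) + b.seen.toNat ≤ 1) ∧
    ((X.foldl CheckData.next b).seen = true ↔ b.seen = true ∨ 0 < X.count (some true)) ∧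
    (X.foldl CheckData.next b).copy = [] := by
  induction X generalizing b with
  | nil =>
    have : b.copy = [] := List.length_eq_zero_iff.1 hX.symm
    have h : b.seen.toNat ≤ 1 := Bool.toNat_le _
    simp [this, h]
  | cons a X ih =>
    obtain ⟨ok, seen, C⟩ := b
    match C with
    | [] => simp at hX
    | c :: C =>
      obtain ⟨h1, h2, h3⟩ := ih (CheckData.next ⟨ok, seen, c :: C⟩ a)
        (by simpa [CheckData.next] using hX)
      rw [List.foldl_cons, h1, h2, h3]
      refine ⟨?_, ?_, rfl⟩
      · by_cases ha : a = some true
        · subst ha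
          cases ok <;> cases seen <;> simp [CheckData.next, isTrue]
          tauto
        · have ha' : (a == some true) = false := by simpa using ha
          cases ok <;> cases seen <;> simp [CheckData.next, isTrue, ha, ha', and_assoc]
      · by_cases ha : a = some true
        · subst ha
          cases seen <;> simp [CheckData.next, isTrue]
        · cases seen <;> simp [CheckData.next, isTrue, ha]

/-- Whether all paths of the lengths `n` and `n + 1` from the states in `X` lead to the same
state. -/
def isFocused (rows : List (List Bool)) (n : ℕ) (X : List (Option Bool)) : Bool :=
  ((nextSet rows)^[n] X == (nextSet rows)^[n + 1] X) &&
    ((nextSet rows)^[n] X).count (some true) == 1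

theorem eval_checkLoop (v : Register) (R K I P X C : List (Option Bool)) (hX : X.length ≤ n) :
    (forEach 0 .cur checkSymbol).eval n (v, tapes R [] K I [] P X [] C) =
      ({ v with
          sym := none
          ok := (X.foldl CheckData.next ⟨v.ok, v.seen, C⟩).ok
          seen := (X.foldl CheckData.next ⟨v.ok, v.seen, C⟩).seen },
        tapes R [] K I [] P [] [] (X.foldl CheckData.next ⟨v.ok, v.seen, C⟩).copy) :=
  eval_forEach (n := n) 0 .cur checkSymbol
    (fun b : CheckData => { v with sym := none, ok := b.ok, seen := b.seen })
    (fun b l => tapes R [] K I [] P l [] b.copy)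
    (fun b l => l.foldl CheckData.next b) (fun b a _ => b.next a)
    (fun _ => rfl) (fun _ _ _ => rfl) (fun _ => rfl) (fun _ _ => tapes_cur ..) (by simp)
    (fun _ _ => True) (fun _ _ _ _ => trivial)
    (fun b a l _ => by simp [checkSymbol, CheckData.next])
    v ⟨v.ok, v.seen, C⟩ X rfl hX trivial

theorem rows_length_add_two_le (h0 : rows ≠ []) (hw : ∀ l ∈ rows, l.length = rows.length + 2) :
    rows.length + 2 ≤ (encodeRows rows).length := by
  obtain ⟨l, hl⟩ := List.exists_mem_of_ne_nil rows h0
  rw [← hw l hl]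
  exact length_le_length_encodeRows hl

theorem eval_check (h0 : rows ≠ []) (hw : ∀ l ∈ rows, l.length = rows.length + 2)
    (hn : (encodeRows rows).length ≤ n) (v : Register)
    (hv : v = { v with active := false, bit := false, acc := false, seen := false })
    (K I P : List (Option Bool)) (hP : P.length ≤ rows.length) :
    check.eval n (v, tapes (encodeRows rows) [] K I [] P [] [] []) =
      ({ v with sym := none, ok := v.ok && isFocused rows n P },
        tapes (encodeRows rows) [] K I [] P [] [] []) := by
  have hlen := rows_length_add_two_le h0 hw
  -- `P` may be shorter than the list of rows, but after at least one pass the vector has full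
  -- length, as the comparison requires.
  obtain ⟨m, rfl⟩ : ∃ m, n = m + 1 := ⟨n - 1, by omega⟩
  obtain ⟨a, ha⟩ := eval_iterate_pass h0 hw hn { v with sym := none } (by rw [hv]) K I P P [] hP
    (m + 1)
  have hP' : P.length ≤ m + 1 := by omega
  set X := (nextSet rows)^[m + 1] P with hX
  have hXlen : X.length = rows.length := by
    rw [hX, Function.iterate_succ_apply', length_nextSet h0 hw]
  have hX1 : X.length ≤ m + 1 := by omega
  have hX2 : (nextSet rows X).length = rows.length := length_nextSet h0 hw X
  have hX3 : (nextSet rows X).length ≤ m + 1 := by omega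
  rw [check, eval_block_cons, eval_move (by simp) _ (by simpa using hP')]
  simp only [tapes_scratch, tapes_point, update_scratch, update_point]
  rw [eval_block_cons, eval_move₂ (by simp) (by simp) (by simp) _ (by simpa using hP')]
  simp only [tapes_scratch, tapes_point, tapes_cur, update_scratch, update_point, update_cur,
    List.append_nil, List.reverse_reverse]
  rw [eval_block_cons, eval_loop, ha, eval_block_cons, eval_move (by simp) _ (by simpa using hX1)]
  simp only [tapes_scratch, tapes_cur, update_scratch, update_cur]
  rw [eval_block_cons, eval_move₂ (by simp) (by simp) (by simp) _ (by simpa using hX1)]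
  simp only [tapes_scratch, tapes_copy, tapes_cur, update_scratch, update_copy, update_cur,
    List.append_nil, List.reverse_reverse]
  rw [eval_block_cons, eval_pass rows hn _ _ _ _ _ _ hXlen.le, eval_block_cons, eval_load,
    eval_block_cons, eval_checkLoop _ _ _ _ _ _ _ hX3, eval_block_cons, eval_load, eval_block_nil]
  obtain ⟨h1, h2, h3⟩ := CheckData.foldl_next (nextSet rows X) ⟨v.ok, false, X⟩
    (hX2.trans hXlen.symm)
  simp only [h3]
  have hok : (((nextSet rows X).foldl CheckData.next ⟨v.ok, false, X⟩).ok &&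
      ((nextSet rows X).foldl CheckData.next ⟨v.ok, false, X⟩).seen) =
      (v.ok && isFocused rows (m + 1) P) := by
    rw [Bool.eq_iff_iff, Bool.and_eq_true, h1, h2, isFocused, Bool.and_eq_true, Bool.and_eq_true,
      beq_iff_eq, beq_iff_eq, Function.iterate_succ_apply' _ (m + 1), ← hX]
    simp only [Bool.toNat_false, Bool.false_eq_true, false_or, add_zero]
    constructor
    · rintro ⟨⟨g1, g2, g3⟩, g4⟩
      rw [g2] at g3 g4
      exact ⟨g1, g2.symm, by omega⟩
    · rintro ⟨g1, g2, g3⟩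
      rw [← g2, g3]
      exact ⟨⟨g1, rfl, le_rfl⟩, Nat.one_pos⟩
  rw [hok, hv]

/-- Test all tails of the list. -/
def allFocused (rows : List (List Bool)) (n : ℕ) : Bool → List (Option Bool) → Bool
  | ok, [] => ok
  | ok, a :: l => allFocused rows n (if a == some false then ok && isFocused rows n l else ok) l

/-- After a `false` is popped, what remains on `point` is `j` times `false` and a `true`, the
truncated unit vector of state `j`. So popping the stack enumerates the states, and the last `true`
triggers no test. -/
theorem allFocused_replicate (ok : Bool) (m : ℕ) :
    allFocused rows n ok (List.replicate m (some false) ++ [some true]) = true ↔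
      ok = true ∧
        ∀ j < m, isFocused rows n (List.replicate j (some false) ++ [some true]) = true := by
  induction m generalizing ok with
  | zero => simp [allFocused]
  | succ m ih =>
    rw [List.replicate_succ, List.cons_append, allFocused, ih]
    simp only [beq_self_eq_true, if_true, Bool.and_eq_true]
    constructor
    · rintro ⟨⟨h1, h2⟩, h3⟩
      refine ⟨h1, fun j hj => ?_⟩
      rcases Nat.lt_succ_iff_lt_or_eq.1 hj with h | rfl
      · exact h3 j h
      · exact h2
    · rintro ⟨h1, h2⟩
      exact ⟨⟨h1, h2 m (by omega)⟩, fun j hj => h2 j (by omega)⟩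

theorem eval_checkAll (h0 : rows ≠ []) (hw : ∀ l ∈ rows, l.length = rows.length + 2)
    (hn : (encodeRows rows).length ≤ n) (v : Register)
    (hv : v = { v with sym := none, active := false, bit := false, acc := false, seen := false })
    (K I P : List (Option Bool)) (hP : P.length ≤ rows.length + 1) :
    checkAll.eval n (v, tapes (encodeRows rows) [] K I [] P [] [] []) =
      ({ v with ok := allFocused rows n v.ok P },
        tapes (encodeRows rows) [] K I [] [] [] [] []) := by
  have hlen := rows_length_add_two_le h0 hw
  have hsym : v.sym = none := by rw [hv]
  have h := eval_forEach (n := n) 3 .point checkPoint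
    (fun b : Bool => { v with sym := none, ok := b })
    (fun _ l => tapes (encodeRows rows) [] K I [] l [] [] [])
    (allFocused rows n) (fun b a l => if a == some false then b && isFocused rows n l else b)
    (fun _ => rfl) (fun _ _ _ => rfl) (fun _ => rfl) (fun _ _ => tapes_point ..) (by simp)
    (fun _ l => l.length ≤ rows.length + 1) (fun _ _ _ h => (Nat.le_succ _).trans h)
    (fun b a l hal => by
      have hl : l.length ≤ rows.length := by simpa using hal
      by_cases ha : a = some false
      · subst ha
        have h1 := eval_check h0 hw hn { v with sym := some (some false), ok := b } (by rw [hv])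
          K I l hl
        simp [checkPoint, h1]
      · simp [checkPoint, ha])
    v v.ok P (by rw [← hsym]) (by omega) hP
  rw [checkAll, h, ← hsym]

/-! #### Reading the word whose length is the number -/

/-- The number with the given bits. -/
def value : List (Option Bool) → ℕ
  | [] => 0
  | a :: l => (isTrue (some a)).toNat + 2 * value l

/-- The data which are changed by a decrement. -/
structure DecrementData where
  /-- The borrow. -/
  borrow : Bool
  /-- The new bits, reversed. -/
  scratch : List (Option Bool)

/-- The effect of one bit. -/
def DecrementData.next (b : DecrementData) (a : Option Bool) : DecrementData :=
  ⟨b.borrow && !isTrue (some a), some (isTrue (some a) ^^ b.borrow) :: b.scratch⟩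

/-- Subtraction of the borrow, least significant bit first. A borrow survives only if it meets no
bit `true`; then the bits underflow, which is why that case is excluded from the last claim. -/
theorem DecrementData.foldl_next (l : List (Option Bool)) (b : Bool) (t : List (Option Bool)) :
    ∃ l', l.foldl DecrementData.next ⟨b, t⟩ = ⟨b && value l == 0, l'.reverse ++ t⟩ ∧
      l'.length = l.length ∧ (¬ (b = true ∧ value l = 0) → value l' + b.toNat = value l) := by
  induction l generalizing b t with
  | nil => exact ⟨[], by simp [value], rfl, by cases b <;> simp [value]⟩
  | cons a l ih =>
    obtain ⟨l', h1, h2, h3⟩ := ih (b && !isTrue (some a)) (some (isTrue (some a) ^^ b) :: t)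
    refine ⟨some (isTrue (some a) ^^ b) :: l', ?_, by simp [h2], ?_⟩
    · rw [List.foldl_cons, DecrementData.next, h1]
      simp only [value]
      generalize isTrue (some a) = x
      cases b <;> cases x <;> simp
    · have h4 : isTrue (some (some (isTrue (some a) ^^ b))) = (isTrue (some a) ^^ b) := by
        cases isTrue (some a) ^^ b <;> rfl
      simp only [value, h4]
      revert h3
      cases b <;> cases isTrue (some a) <;> simp
      all_goals omega

end

section

variable {rows : List (List Bool)} {n : ℕ}

theorem eval_decrement (v : Register) (R K I P X C : List (Option Bool)) (hK : K.length ≤ n) :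
    ∃ K', decrement.eval n (v, tapes R [] K I [] P X [] C) =
      ({ v with sym := none, borrow := value K == 0 }, tapes R [] K' I [] P X [] C) ∧
      K'.length = K.length ∧ (value K ≠ 0 → value K' + 1 = value K) := by
  obtain ⟨K', h1, h2, h3⟩ := DecrementData.foldl_next K true []
  have h := eval_forEach (n := n) 0 .key decrementBit
    (fun b : DecrementData => { v with sym := none, borrow := b.borrow })
    (fun b l => tapes R b.scratch l I [] P X [] C)
    (fun b l => l.foldl DecrementData.next b) (fun b a _ => b.next a)
    (fun _ => rfl) (fun _ _ _ => rfl) (fun _ => rfl) (fun _ _ => tapes_key ..) (by simp)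
    (fun _ _ => True) (fun _ _ _ _ => trivial)
    (fun b a l _ => by simp [decrementBit, DecrementData.next])
    { v with borrow := true } ⟨true, []⟩ K rfl hK trivial
  rw [h1] at h
  have hK' : K'.reverse.length ≤ n := by rw [List.length_reverse, h2]; exact hK
  refine ⟨K', ?_, h2, fun h0 => h3 fun h4 => h0 h4.2⟩
  rw [decrement, eval_block_cons, eval_load, eval_block_cons, h, eval_block_cons,
    eval_move (by simp) _ (by simpa using hK')]
  simp

/-- While `borrow` is clear, the remaining number plus the iterations made is the original number.
Once it is set, the remaining iterations are idle. -/
theorem eval_advance (h0 : rows ≠ []) (hw : ∀ l ∈ rows, l.length = rows.length + 2)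
    (hn : (encodeRows rows).length ≤ n) (v : Register)
    (hv : v = { v with sym := none, active := false, bit := false, borrow := false })
    (K I P X C : List (Option Bool)) (hX : X.length ≤ rows.length) (hK : K.length ≤ n) :
    ∃ K' a b, advance.eval n (v, tapes (encodeRows rows) [] K I [] P X [] C) =
      ({ v with acc := a, borrow := b }, tapes (encodeRows rows) [] K' I [] P
        ((nextSet rows)^[min (value K) n] X) [] C) := by
  have key : ∀ m, ∃ K' a b,
      (advanceStep.eval n)^[m] (v, tapes (encodeRows rows) [] K I [] P X [] C) =
        ({ v with acc := a, borrow := b }, tapes (encodeRows rows) [] K' I [] P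
          ((nextSet rows)^[min (value K) m] X) [] C) ∧ K'.length = K.length ∧
        (b = false → value K' + m = value K) ∧ (b = true → value K < m) := by
    intro m
    induction m with
    | zero =>
      refine ⟨K, v.acc, false, ?_, rfl, by simp, by simp⟩
      rw [hv]
      simp
    | succ m ih =>
      obtain ⟨K', a, b, h1, h2, h3, h4⟩ := ih
      rw [Function.iterate_succ_apply', h1]
      cases b with
      | true =>
        have h5 := h4 rfl
        refine ⟨K', a, true, ?_, h2, by simp, fun _ => by omega⟩
        rw [min_eq_left (by omega : value K ≤ m), min_eq_left (by omega : value K ≤ m + 1)]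
        simp [advanceStep]
      | false =>
        have h5 := h3 rfl
        obtain ⟨K'', g1, g2, g3⟩ := eval_decrement (n := n) { v with acc := a, borrow := false }
          (encodeRows rows) K' I P ((nextSet rows)^[min (value K) m] X) C (by omega)
        by_cases hz : value K' = 0
        · refine ⟨K'', a, true, ?_, g2.trans h2, by simp, fun _ => by omega⟩
          rw [min_eq_left (by omega : value K ≤ m)] at g1 ⊢
          rw [min_eq_left (by omega : value K ≤ m + 1), hv]
          rw [hv] at g1
          simp [advanceStep, g1, hz]
        · have g4 := g3 hz
          refine ⟨K'', accepting rows ((nextSet rows)^[m] X), false, ?_, g2.trans h2,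
            fun _ => by omega, by simp⟩
          rw [min_eq_right (by omega : m ≤ value K)] at g1 ⊢
          rw [min_eq_right (by omega : m + 1 ≤ value K), Function.iterate_succ_apply']
          rw [hv] at g1 ⊢
          simp [advanceStep, g1, hz, eval_pass rows hn _ _ _ _ _ _
            (length_iterate_nextSet_le h0 hw hX m)]
  obtain ⟨K', a, b, h, -⟩ := key n
  exact ⟨K', a, b, h⟩

/-! #### Comparing the acceptance of words -/

/-- A pass reports the acceptance of the set it starts from, so the first one records the reference
value for `X`. -/
theorem eval_compareWords (h0 : rows ≠ []) (hw : ∀ l ∈ rows, l.length = rows.length + 2)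
    (hn : (encodeRows rows).length ≤ n) (v : Register)
    (hv : v = { v with sym := none, active := false, bit := false })
    (K I P X C : List (Option Bool)) (hX : X.length ≤ rows.length) :
    ((compareWords.eval n (v, tapes (encodeRows rows) [] K I [] P X [] C)).1.ok = true ↔
      v.ok = true ∧ ∀ i < n, accepting rows ((nextSet rows)^[i + 1] X) = accepting rows X) := by
  have key : ∀ m, ∃ a c, (compareStep.eval n)^[m]
        ({ v with acc := accepting rows X, ref := accepting rows X },
          tapes (encodeRows rows) [] K I [] P (nextSet rows X) [] C) =
      ({ v with acc := a, ref := accepting rows X, ok := c }, tapes (encodeRows rows) [] K I [] P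
        ((nextSet rows)^[m + 1] X) [] C) ∧ (c = true ↔ v.ok = true ∧
          ∀ i < m, accepting rows ((nextSet rows)^[i + 1] X) = accepting rows X) := by
    intro m
    induction m with
    | zero => exact ⟨_, v.ok, rfl, by simp⟩
    | succ m ih =>
      obtain ⟨a, c, h1, h2⟩ := ih
      refine ⟨accepting rows ((nextSet rows)^[m + 1] X),
        c && (accepting rows ((nextSet rows)^[m + 1] X) == accepting rows X), ?_, ?_⟩
      · rw [Function.iterate_succ_apply', h1, Function.iterate_succ_apply' _ (m + 1), compareStep,
          eval_block_cons, eval_pass rows hn _ _ _ _ _ _ (length_iterate_nextSet_le h0 hw hX _), hv]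
        simp
      · rw [Bool.and_eq_true, h2, beq_iff_eq, Nat.forall_lt_succ_right, and_assoc]
  obtain ⟨a, c, h1, h2⟩ := key n
  have h3 : compareWords.eval n (v, tapes (encodeRows rows) [] K I [] P X [] C) =
      (compareStep.eval n)^[n] ({ v with acc := accepting rows X, ref := accepting rows X },
        tapes (encodeRows rows) [] K I [] P (nextSet rows X) [] C) := by
    rw [compareWords, eval_block_cons, eval_pass rows hn _ _ _ _ _ _ hX, eval_block_cons, eval_load,
      eval_block_cons, eval_loop, eval_block_nil, hv]
  rw [h3, h1]
  exact h2

end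

/-- The outcome of the program. -/
theorem eval_decisionProgram {n : ℕ} (key : List Bool) (rows : List (List Bool)) (h0 : rows ≠ [])
    (hw : ∀ l ∈ rows, l.length = rows.length + 2)
    (hn : (key.map some ++ none :: encodeRows rows).length ≤ n) :
    (decisionProgram.eval n (⟨none, false, false, false, true, false, false, false, false, false⟩,
      Function.update (fun _ => []) .scratch
        (key.map some ++ none :: encodeRows rows).reverse)).1.ok = true ↔
    (∀ j < rows.length, isFocused rows n (List.replicate j (some false) ++ [some true]) = true) ∧
    ∀ i < n, accepting rows
        ((nextSet rows)^[min (value (key.map some)) n + (i + 1)] (firstSymbols rows)) =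
      accepting rows ((nextSet rows)^[min (value (key.map some)) n] (firstSymbols rows)) := by
  have htapes : (fun _ => [] : Tape → List (Option Bool)) = tapes [] [] [] [] [] [] [] [] [] := by
    funext k
    cases k <;> rfl
  have hrows : ∀ l ∈ rows, l ≠ [] := by
    rintro _ hl rfl
    simpa using hw _ hl
  have hn' : (encodeRows rows).length ≤ n := by simp at hn; omega
  have hkey : (key.map some).length ≤ n := by simp at hn ⊢; omega
  have hlen := rows_length_add_two_le h0 hw
  have hinit : (firstSymbols rows).length = rows.length := by simp [firstSymbols]
  have hinit' : (firstSymbols rows).reverse.length ≤ n := by rw [List.length_reverse]; omega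
  rw [htapes, update_scratch, decisionProgram, eval_block_cons, eval_parse key rows hrows hn,
    eval_block_cons, eval_checkAll h0 hw hn' _ rfl _ _ _ (by simp), eval_block_cons,
    eval_move (by simp) _ (by simpa using hinit')]
  simp only [tapes_initial, tapes_cur, update_initial, update_cur, List.reverse_reverse,
    List.append_nil]
  obtain ⟨K, a, b, h⟩ := eval_advance (n := n) h0 hw hn' ⟨none, false, false, false,
    allFocused rows n true (List.replicate rows.length (some false) ++ [some true]), false, false,
    false, false, true⟩ rfl (key.map some) [] [] (firstSymbols rows) [] hinit.le hkey
  rw [eval_block_cons, h, eval_block_cons, eval_block_nil,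
    eval_compareWords h0 hw hn' _ rfl _ _ _ _ _ (length_iterate_nextSet_le h0 hw hinit.le _),
    allFocused_replicate]
  simp only [true_and, ← Function.iterate_add_apply, Nat.add_comm]

/-! #### The correctness of the decision procedure -/

theorem value_map_encodePosNum (m : PosNum) :
    value ((Computability.encodePosNum m).map some) = (m : ℕ) := by
  induction m with
  | one => rfl
  | bit0 m ih =>
    rw [Computability.encodePosNum, List.map_cons, value, ih, PosNum.cast_bit0]
    change 0 + 2 * (m : ℕ) = _
    omega
  | bit1 m ih =>
    rw [Computability.encodePosNum, List.map_cons, value, ih, PosNum.cast_bit1]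
    change 1 + 2 * (m : ℕ) = _
    omega

theorem value_map_encodeNat (k : ℕ) : value ((Computability.encodeNat k).map some) = k := by
  have h : ∀ m : Num, value ((Computability.encodeNum m).map some) = (m : ℕ)
    | Num.zero => rfl
    | Num.pos m => value_map_encodePosNum m
  exact (h k).trans (Num.to_of_nat k)

/-! ### Automata as bit matrices and sets of states as characteristic vectors -/

section

variable {N : ℕ}

open Classical in
/-- The row of a state: is it initial, is it accepting, and its row of the transition matrix. -/
noncomputable def automatonRow (A : NFA Unit (Fin N)) (p : Fin N) : List Bool :=
  decide (p ∈ A.start) :: decide (p ∈ A.accept) ::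
    (List.finRange N).map fun q => decide (q ∈ A.step p ())

/-- The rows of an automaton. -/
noncomputable def automatonRows (A : NFA Unit (Fin N)) : List (List Bool) :=
  (List.finRange N).map (automatonRow A)

open Classical in
/-- The characteristic vector of a set. -/
noncomputable def vector (S : Set (Fin N)) : List (Option Bool) :=
  (List.finRange N).map fun p => some (decide (p ∈ S))

@[simp] theorem length_automatonRows (A : NFA Unit (Fin N)) : (automatonRows A).length = N := by
  simp [automatonRows]

theorem length_of_mem_automatonRows {A : NFA Unit (Fin N)} {l : List Bool}
    (hl : l ∈ automatonRows A) : l.length = (automatonRows A).length + 2 := by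
  obtain ⟨p, -, rfl⟩ := List.mem_map.1 hl
  simp [automatonRow]

theorem getElem?_automatonRows (A : NFA Unit (Fin N)) (p : ℕ) (l : List Bool) :
    (automatonRows A)[p]? = some l ↔ ∃ h : p < N, automatonRow A ⟨p, h⟩ = l := by
  by_cases h : p < N
  · simp [automatonRows, h]
  · simp [automatonRows, h]

theorem isTrue_addRows_automatonRows (A : NFA Unit (Fin N)) (X : List (Option Bool)) (i : ℕ) :
    isTrue (addRows X [] (automatonRows A))[i]? = true ↔
      ∃ p : Fin N, isTrue X[(p : ℕ)]? = true ∧ (automatonRow A p)[i]? = some true := by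
  rw [isTrue_addRows]
  constructor
  · rintro (h | ⟨p, l, h1, h2, h3⟩)
    · simp [isTrue] at h
    · obtain ⟨hp, rfl⟩ := (getElem?_automatonRows A p l).1 h1
      exact ⟨⟨p, hp⟩, h2, h3⟩
  · rintro ⟨p, h2, h3⟩
    exact Or.inr ⟨p, _, (getElem?_automatonRows A p _).2 ⟨p.2, rfl⟩, h2, h3⟩

@[simp] theorem length_vector (S : Set (Fin N)) : (vector S).length = N := by
  simp [vector]

theorem isTrue_vector (S : Set (Fin N)) (p : Fin N) :
    isTrue (vector S)[(p : ℕ)]? = true ↔ p ∈ S := by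
  simp [vector, isTrue]

theorem ne_none_of_mem_vector (S : Set (Fin N)) : ∀ a ∈ vector S, a ≠ none := by
  intro a ha
  obtain ⟨p, -, rfl⟩ := List.mem_map.1 ha
  simp

/-- `isTrue` confuses `some false` with the separator `none`, which must therefore be excluded. -/
theorem eq_of_isTrue {X Y : List (Option Bool)} (hlen : X.length = Y.length)
    (hX : ∀ a ∈ X, a ≠ none) (hY : ∀ a ∈ Y, a ≠ none)
    (h : ∀ i : ℕ, isTrue X[i]? = true ↔ isTrue Y[i]? = true) : X = Y := by
  refine List.ext_getElem hlen fun i h1 h2 => ?_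
  have h3 := h i
  obtain ⟨x, hx⟩ := Option.ne_none_iff_exists.1 (hX _ (List.getElem_mem h1))
  obtain ⟨y, hy⟩ := Option.ne_none_iff_exists.1 (hY _ (List.getElem_mem h2))
  rw [List.getElem?_eq_getElem h1, List.getElem?_eq_getElem h2, ← hx, ← hy] at h3
  rw [← hx, ← hy]
  cases x <;> cases y <;> simp [isTrue] at h3 ⊢

theorem vector_injective : Function.Injective (vector (N := N)) := by
  intro S T h
  ext p
  rw [← isTrue_vector, h, isTrue_vector]

theorem automatonRows_ne_nil [NeZero N] (A : NFA Unit (Fin N)) : automatonRows A ≠ [] :=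
  List.ne_nil_of_length_pos (by simp [NeZero.pos])

theorem nextSet_eq_vector [NeZero N] (A : NFA Unit (Fin N)) {X : List (Option Bool)}
    {S : Set (Fin N)} (hX : ∀ p : Fin N, isTrue X[(p : ℕ)]? = true ↔ p ∈ S) :
    nextSet (automatonRows A) X = vector (A.stepSet S ()) := by
  have hlen : (nextSet (automatonRows A) X).length = N := by
    rw [length_nextSet (automatonRows_ne_nil A) fun l hl => length_of_mem_automatonRows hl,
      length_automatonRows]
  refine eq_of_isTrue (hlen.trans (length_vector _).symm) (fun a ha => ?_)
    (ne_none_of_mem_vector _) fun i => ?_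
  · exact ne_none_of_mem_addRows _ _ _ (by simp) a (List.mem_of_mem_tail (List.mem_of_mem_tail ha))
  · by_cases hi : i < N
    · rw [isTrue_vector _ ⟨i, hi⟩, nextSet, List.getElem?_tail, List.getElem?_tail,
        isTrue_addRows_automatonRows, NFA.mem_stepSet]
      refine exists_congr fun p => ?_
      rw [hX p]
      simp [automatonRow, hi]
    · rw [List.getElem?_eq_none (by omega), List.getElem?_eq_none (by simpa using hi)]

theorem nextSet_vector [NeZero N] (A : NFA Unit (Fin N)) (S : Set (Fin N)) :
    nextSet (automatonRows A) (vector S) = vector (A.stepSet S ()) :=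
  nextSet_eq_vector A (isTrue_vector S)

theorem iterate_nextSet_vector [NeZero N] (A : NFA Unit (Fin N)) (S : Set (Fin N)) (m : ℕ) :
    (nextSet (automatonRows A))^[m] (vector S) = vector (A.evalFrom S (List.replicate m ())) := by
  induction m generalizing S with
  | zero => rfl
  | succ m ih =>
    rw [Function.iterate_succ_apply, nextSet_vector, ih, List.replicate_succ, NFA.evalFrom_cons]

theorem accepting_vector (A : NFA Unit (Fin N)) (S : Set (Fin N)) :
    accepting (automatonRows A) (vector S) = true ↔ ∃ p ∈ A.accept, p ∈ S := by
  rw [accepting, List.head?_eq_getElem?, List.getElem?_tail, isTrue_addRows_automatonRows]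
  refine exists_congr fun p => ?_
  rw [isTrue_vector, and_comm]
  simp [automatonRow]

theorem firstSymbols_automatonRows (A : NFA Unit (Fin N)) :
    firstSymbols (automatonRows A) = vector A.start := by
  simp [firstSymbols, automatonRows, automatonRow, vector]

theorem accepting_iterate_nextSet [NeZero N] (A : NFA Unit (Fin N)) (j : ℕ) :
    accepting (automatonRows A)
        ((nextSet (automatonRows A))^[j] (firstSymbols (automatonRows A))) = true ↔
      List.replicate j () ∈ A.accepts := by
  rw [firstSymbols_automatonRows, iterate_nextSet_vector, accepting_vector, NFA.mem_accepts]

theorem count_vector_eq_one (S : Set (Fin N)) :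
    (vector S).count (some true) = 1 ↔ ∃ s, S = {s} := by
  classical
  have h : (vector S).count (some true) = S.toFinset.card := by
    rw [vector, List.count, List.countP_map, List.countP_eq_length_filter,
      ← List.toFinset_card_of_nodup ((List.nodup_finRange N).filter _)]
    congr 1
    ext p
    simp
  rw [h, Finset.card_eq_one]
  refine exists_congr fun s => ?_
  rw [← Finset.coe_inj, Set.coe_toFinset, Finset.coe_singleton]

/-- The list on the left has only `p + 1` entries and need not be a `vector`; the first step turns
it into one, hence `m + 1`. -/
theorem iterate_nextSet_singleton [NeZero N] (A : NFA Unit (Fin N)) (p : Fin N) (m : ℕ) :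
    (nextSet (automatonRows A))^[m + 1] (List.replicate p (some false) ++ [some true]) =
      vector (A.evalFrom {p} (List.replicate (m + 1) ())) := by
  have h : ∀ q : Fin N, isTrue (List.replicate p (some false) ++ [some true])[(q : ℕ)]? = true ↔
      q ∈ ({p} : Set (Fin N)) := by
    intro q
    rw [Set.mem_singleton_iff, Fin.ext_iff]
    rcases lt_trichotomy (q : ℕ) p with hq | hq | hq
    · simp [List.getElem?_append, hq, isTrue, hq.ne]
    · simp [hq, isTrue]
    · rw [List.getElem?_eq_none (by simpa using hq)]
      simp [isTrue, hq.ne']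
  rw [Function.iterate_succ_apply, nextSet_eq_vector A h, iterate_nextSet_vector,
    List.replicate_succ, NFA.evalFrom_cons]

theorem isFocused_singleton [NeZero N] (A : NFA Unit (Fin N)) {n : ℕ} (hn : 0 < n) (p : Fin N) :
    isFocused (automatonRows A) n (List.replicate p (some false) ++ [some true]) = true ↔
      ∃ s, (∀ q, A.ReachesIn n p q ↔ q = s) ∧ ∀ q, A.ReachesIn (n + 1) p q ↔ q = s := by
  obtain ⟨m, rfl⟩ : ∃ m, n = m + 1 := ⟨n - 1, by omega⟩
  have h : ∀ m s, (∀ q, A.ReachesIn m p q ↔ q = s) ↔ A.evalFrom {p} (List.replicate m ()) = {s} :=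
    fun m s => Set.ext_iff.symm
  simp only [h]
  rw [isFocused, Bool.and_eq_true, beq_iff_eq, beq_iff_eq, iterate_nextSet_singleton,
    iterate_nextSet_singleton, count_vector_eq_one, vector_injective.eq_iff]
  constructor
  · rintro ⟨h1, s, h2⟩
    exact ⟨s, h2, h1.symm.trans h2⟩
  · rintro ⟨s, h1, h2⟩
    exact ⟨h1.trans h2.symm, s, h1⟩

end

theorem encodeInstance_eq (x : UnaryNFA × ℕ) : encodeInstance x =
    (Computability.encodeNat x.2).map some ++ none :: encodeRows (automatonRows x.1.2) := by
  have h : encodeState x.1.2 = fun p => (automatonRow x.1.2 p).map some ++ [none] := by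
    funext p
    simp [encodeState, automatonRow]
  simp [encodeInstance, encodeRows, automatonRows, List.flatMap_map, h]

/-- The input length plays the role of `m` both in `isPtNFA_iff` and in the comparison of words. -/
theorem decidableInPolyTime_isKPiecewiseTestable : DecidableInPolyTime encodeInstance
    {x : UnaryNFA × ℕ | x.1.2.IsPtNFA ∧ IsKPiecewiseTestable x.2 x.1.2.accepts} := by
  refine LoopProgram.decidableInPolyTime decisionProgram decisionProgram_below (i := .rows)
    (t := .scratch) (by simp)
    ⟨none, false, false, false, true, false, false, false, false, false⟩ (fun v => v.ok) _ _ ?_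
  rintro ⟨⟨N, A⟩, k⟩
  have hrows : ∀ l ∈ automatonRows A, l.length = (automatonRows A).length + 2 := fun l hl =>
    length_of_mem_automatonRows hl
  have hx : encodeInstance (⟨N, A⟩, k) = (Computability.encodeNat k).map some ++
    none :: encodeRows (automatonRows A) := encodeInstance_eq _
  -- A single row is already longer than the number of states.
  have hlen : N + 1 ≤ (encodeInstance (⟨N, A⟩, k)).length := by
    have h := rows_length_add_two_le (automatonRows_ne_nil A) hrows
    rw [length_automatonRows] at h
    rw [hx, List.length_append, List.length_cons]
    omega
  have h := eval_decisionProgram (Computability.encodeNat k) (automatonRows A)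
    (automatonRows_ne_nil A) hrows (n := (encodeInstance (⟨N, A⟩, k)).length) (by rw [hx])
  rw [← hx, value_map_encodeNat] at h
  refine h.trans ?_
  have hcard : Fintype.card (Fin (N + 1)) ≤ (encodeInstance (⟨N, A⟩, k)).length := by
    rwa [Fintype.card_fin]
  have h1 : (∀ j < (automatonRows A).length, isFocused (automatonRows A)
      (encodeInstance (⟨N, A⟩, k)).length (List.replicate j (some false) ++ [some true]) = true) ↔
      A.IsPtNFA := by
    rw [NFA.isPtNFA_iff hcard,
      length_automatonRows, ← Fin.forall_iff (p := fun j : Fin (N + 1) => isFocused _ _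
        (List.replicate (j : ℕ) (some false) ++ [some true]) = true)]
    exact forall_congr' fun p => isFocused_singleton A (by omega) p
  rw [h1]
  refine and_congr_right fun hA => ?_
  rw [hA.isKPiecewiseTestable_iff_of_card_le k hcard]
  refine forall₂_congr fun i _ => ?_
  rw [Bool.eq_iff_iff, accepting_iterate_nextSet, accepting_iterate_nextSet]

end UnaryPiecewise

/-- The pairs of a ptNFA `A` over a unary alphabet and a number `k`, in binary, for which `L(A)`
is `k`-piecewise testable are decidable in polynomial time. Moreover, `L(A)` is `k`-piecewise
testable if and only if the acceptance of `a^j` agrees with that of `a^k` whenever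
`k < j ≤ depth(A)`. -/
theorem theorem6p10 :
    DecidableInPolyTime encodeInstance
      {x : UnaryNFA × ℕ | x.1.2.IsPtNFA ∧ IsKPiecewiseTestable x.2 x.1.2.accepts} ∧
    ∀ (A : UnaryNFA) (k : ℕ), A.2.IsPtNFA →
      (IsKPiecewiseTestable k A.2.accepts ↔
        ∀ j, k < j → j ≤ A.2.depth →
          (List.replicate j () ∈ A.2.accepts ↔ List.replicate k () ∈ A.2.accepts)) := by
  exact ⟨UnaryPiecewise.decidableInPolyTime_isKPiecewiseTestable,
    fun _ k hA => hA.isKPiecewiseTestable_iff_of_depth_le k⟩
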